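/- For $\theta>0$ and $\sigma\in\mathbb R$ consider on $\mathbb R$ the equation $$u''+(1+i\sigma)^2c^{-2}(x)\,u=0,\qquad c^{-2}(x)=1+\theta x_+,\quad x_+=\max(x,0),\tag{$E_\sigma$}$$ whose solutions are understood to be $C^1$ on $\mathbb R$ (hence classical). A nonzero solution $u$ of $(E_0)$ is called *outgoing to $+\infty$* (resp. *outgoing to $-\infty$*, *incoming from $-\infty$*) if there are $\sigma_n\to0$ with $\sigma_n<0$ (resp. $\sigma_n<0$, $\sigma_n>0$) and solutions $u_n$ of $(E_{\sigma_n})$ with $u_n(x)\to0$ as $x\to+\infty$ (resp. $x\to-\infty$, $x\to-\infty$) for each $n$, such that $u_n\to u$ uniformly on compact sets. Let $v^{>}=c^{1/2}e^{-i\phi}$ and $v^{<}=c^{1/2}e^{i\phi}$ with $\phi(x)=\int_0^x dy/c(y)$. Let $u^{<}_{-\infty}$ be the solution outgoing to $-\infty$ with $u^{<}_{-\infty}/v^{<}\to1$ at $-\infty$, and $u^{>}_{-\infty}$ the solution incoming from $-\infty$ with $u^{>}_{-\infty}/v^{>}\to1$ at $-\infty$. The *reflection coefficient* is $R=R(\theta)=A/B$,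 where $u=A\,u^{<}_{-\infty}+B\,u^{>}_{-\infty}$, $B\neq0$, is a solution outgoing to $+\infty$. **Lemma.** There exist $\theta_0>0$ and $C$ such that for all $0<\theta<\theta_0$ the reflection coefficient $R(\theta)$ exists, is unique, and satisfies $$\left|R(\theta)-\frac{i\theta}{8}\right|\le C\theta^2 .$$ Moreover $\frac i8=\frac1{(2i)^3}$, i.e. $R(\theta)=\frac{1}{(2i)^3}\theta+O(\theta^2)$ as $\theta\to0^+$. -/

import Mathlib

open Filter Topology

/-- The index of refraction squared `c⁻²(x) = 1 + θ x₊^α` of the fractional ramp. -/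
noncomputable def invSqSpeed (α θ x : ℝ) : ℝ := 1 + θ * (max x 0) ^ α

/-- The wave speed `c(x) = (1 + θ x₊^α)^(-1/2)`. -/
noncomputable def waveSpeed (α θ x : ℝ) : ℝ := (Real.sqrt (invSqSpeed α θ x))⁻¹

/-- The travel time `φ(x) = ∫₀ˣ dy / c(y)`. -/
noncomputable def phase (α θ x : ℝ) : ℝ := ∫ y in (0 : ℝ)..x, 1 / waveSpeed α θ y

/-- The right-going WKB function `v^>(x) = c(x)^(1/2) e^{-iφ(x)}`. -/
noncomputable def wkbRight (α θ x : ℝ) : ℂ :=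
  (Real.sqrt (waveSpeed α θ x) : ℂ) * Complex.exp (-Complex.I * (phase α θ x : ℂ))

/-- The left-going WKB function `v^<(x) = c(x)^(1/2) e^{iφ(x)}`. -/
noncomputable def wkbLeft (α θ x : ℝ) : ℂ :=
  (Real.sqrt (waveSpeed α θ x) : ℂ) * Complex.exp (Complex.I * (phase α θ x : ℂ))

/-- `u` is a (classical, on all of `ℝ`) solution of `u'' + (1 + iσ)² c⁻²(x) u = 0`.
The model equation `u'' + c⁻²(x) u = 0` is the case `σ = 0`. -/
def IsWaveSolution (α θ σ : ℝ) (u : ℝ → ℂ) : Prop :=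
  Differentiable ℝ u ∧ ∀ x : ℝ,
    HasDerivAt (deriv u) (-((1 + Complex.I * (σ : ℂ)) ^ 2 * (invSqSpeed α θ x : ℂ) * u x)) x

/-- Limiting absorption: `u` is a nonzero solution of the model equation and the limit, uniformly
on compact sets, of solutions of the equations with parameters `σₙ → 0`, `σₙ ∈ S`, each of which
tends to `0` along the filter `l` (`atTop` for `x → +∞`, `atBot` for `x → -∞`). -/
def IsPolarizedWave (α θ : ℝ) (S : Set ℝ) (l : Filter ℝ) (u : ℝ → ℂ) : Prop :=
  IsWaveSolution α θ 0 u ∧ u ≠ 0 ∧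
    ∃ (σ : ℕ → ℝ) (v : ℕ → ℝ → ℂ),
      (∀ n, σ n ∈ S) ∧ Tendsto σ atTop (𝓝 0) ∧
      (∀ n, IsWaveSolution α θ (σ n) (v n)) ∧
      (∀ n, Tendsto (v n) l (𝓝 0)) ∧
      TendstoLocallyUniformly v u atTop

/-- Outgoing to `+∞` (transmitted waves): `σ < 0`, decay at `+∞`. -/
def IsOutgoingToPosInf (α θ : ℝ) (u : ℝ → ℂ) : Prop :=
  IsPolarizedWave α θ (Set.Iio 0) atTop u

/-- Outgoing to `-∞` (reflected waves): `σ < 0`, decay at `-∞`. -/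
def IsOutgoingToNegInf (α θ : ℝ) (u : ℝ → ℂ) : Prop :=
  IsPolarizedWave α θ (Set.Iio 0) atBot u

/-- Incoming from `-∞` (incident waves): `σ > 0`, decay at `-∞`. -/
def IsIncomingFromNegInf (α θ : ℝ) (u : ℝ → ℂ) : Prop :=
  IsPolarizedWave α θ (Set.Ioi 0) atBot u

/-- `R` is a reflection coefficient: some outgoing wave to `+∞` is `A u^<_{-∞} + B u^>_{-∞}` with
`B ≠ 0` and `R = A / B`, where `u^<_{-∞}` and `u^>_{-∞}` are the reflected and the incident wave
normalized by `u^</v^< → 1` and `u^>/v^> → 1` at `-∞`. -/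
def IsReflectionCoefficient (α θ : ℝ) (R : ℂ) : Prop :=
  ∃ (u uRefl uInc : ℝ → ℂ) (A B : ℂ),
    IsOutgoingToPosInf α θ u ∧
    IsOutgoingToNegInf α θ uRefl ∧
    Tendsto (fun x => uRefl x / wkbLeft α θ x) atBot (𝓝 1) ∧
    IsIncomingFromNegInf α θ uInc ∧
    Tendsto (fun x => uInc x / wkbRight α θ x) atBot (𝓝 1) ∧
    (∀ x, u x = A * uRefl x + B * uInc x) ∧
    B ≠ 0 ∧ R = A / B

/-!
On `x ≥ 0` the equation `u'' + k²(1 + θx)u = 0`, `k = 1 + iσ`, is Airy's equation in the variable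
`a² = b²(1 + θx)` with `b³ = ±ik/θ`. Moving the contour of the Airy integral to a straight line
through the saddle point gives, up to a constant factor,
`Ai(a²) = e^{-2a³/3} ∫ e^{-a r² - i r³/3} dr` for `Re a > 0`, so that everything can be read off
from absolutely convergent integrals over `ℝ`, the moments `airyMoment n a`. Integration by parts
(`airyMoment_recurrence`) yields the differential equation, and comparison with a Gaussian integral
shows that the zeroth moment is of exact order `|a|^{-1/2}` in the sector `Re a ≥ |a|/2`, and that
the third moment, whose Gaussian part vanishes by oddness, is smaller by a factor `|a|⁻³`.

The factor `e^{-2a³/3}` decides the behaviour at `+∞`: for `σ < 0` the solution with `b³ = ik/θ`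
decays and the one with `b³ = -ik/θ` grows. The Wronskian identity `eq_mul_of_tendsto_zero` then
says that the decaying solutions form a line, and likewise at `-∞`, where the solutions are the
plane waves `e^{±ikx}`. All these solutions depend continuously on `(σ, x)`, down to `σ = 0`, so the
limiting absorption principle selects exactly the multiples of the `σ = 0` members of these families
(`IsPolarizedWave.eq_mul`, `isPolarizedWave_of_family`).

Hence `R = (1 - ip)/(1 + ip)` where `p` is the logarithmic derivative at `0` of the Airy solution
with `b³ = i/θ` (`isReflectionCoefficient_iff`). The recurrences give the exact formula
`p = -i - (θ/4)(1 - iε)`, with `ε` the ratio of the third to the zeroth moment at `b`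
(`airySlope_eq`), and `ε = O(|b|⁻³) = O(θ)`; expanding in `θ` gives `R = iθ/8 + O(θ²)`.
-/

open MeasureTheory

/-! ### Moments of the cubic Gaussian -/

/-- The integrand `e^{-a r² - i r³/3}`, obtained from the contour integral for the Airy function by
moving the contour to a straight line through the saddle point; it decays for `Re a > 0`. -/
noncomputable def airyKernel (a : ℂ) (r : ℝ) : ℂ :=
  Complex.exp (-a * (r : ℂ) ^ 2 - Complex.I * (r : ℂ) ^ 3 / 3)

/-- The moments `∫ rⁿ e^{-a r² - i r³/3} dr`. -/
noncomputable def airyMoment (n : ℕ) (a : ℂ) : ℂ := ∫ r : ℝ, (r : ℂ) ^ n * airyKernel a r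

lemma norm_airyKernel (a : ℂ) (r : ℝ) : ‖airyKernel a r‖ = Real.exp (-a.re * r ^ 2) := by
  rw [airyKernel, Complex.norm_exp]
  congr 1
  have h : -a * (r : ℂ) ^ 2 - Complex.I * (r : ℂ) ^ 3 / 3
      = -a * ((r ^ 2 : ℝ) : ℂ) - Complex.I * ((r ^ 3 / 3 : ℝ) : ℂ) := by push_cast; ring
  rw [h, Complex.sub_re, Complex.mul_re, Complex.mul_re]
  simp only [Complex.ofReal_im, Complex.ofReal_re, Complex.I_re, Complex.I_im, Complex.neg_re]
  ring

lemma norm_pow_mul_airyKernel (n : ℕ) (a : ℂ) (r : ℝ) :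
    ‖(r : ℂ) ^ n * airyKernel a r‖ = |r| ^ n * Real.exp (-a.re * r ^ 2) := by
  rw [norm_mul, norm_airyKernel, norm_pow, Complex.norm_real, Real.norm_eq_abs]

lemma continuous_airyKernel (a : ℂ) : Continuous (airyKernel a) := by
  unfold airyKernel; fun_prop

lemma integrable_abs_pow_mul_gaussian (n : ℕ) {b : ℝ} (hb : 0 < b) :
    Integrable fun r : ℝ => |r| ^ n * Real.exp (-b * r ^ 2) := by
  have h := (integrable_rpow_mul_exp_neg_mul_sq hb (s := n)
    (by have : (0 : ℝ) ≤ n := n.cast_nonneg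
        linarith)).norm
  refine h.congr (Eventually.of_forall fun r => ?_)
  simp [Real.rpow_natCast]

lemma integrable_pow_mul_airyKernel (n : ℕ) {a : ℂ} (ha : 0 < a.re) :
    Integrable fun r : ℝ => (r : ℂ) ^ n * airyKernel a r := by
  refine (integrable_abs_pow_mul_gaussian n ha).mono' ?_ ?_
  · exact (Continuous.mul (by fun_prop) (continuous_airyKernel a)).aestronglyMeasurable
  · exact Eventually.of_forall fun r => (norm_pow_mul_airyKernel n a r).le

lemma hasDerivAt_airyMoment (n : ℕ) {a : ℂ} (ha : 0 < a.re) :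
    HasDerivAt (airyMoment n) (-airyMoment (n + 2) a) a := by
  have hs : {z : ℂ | a.re / 2 < z.re} ∈ 𝓝 a :=
    (isOpen_lt continuous_const Complex.continuous_re).mem_nhds (by simp; linarith)
  have key := hasDerivAt_integral_of_dominated_loc_of_deriv_le (μ := volume)
    (F := fun z (r : ℝ) => (r : ℂ) ^ n * airyKernel z r)
    (F' := fun z (r : ℝ) => -((r : ℂ) ^ (n + 2) * airyKernel z r))
    (bound := fun r => |r| ^ (n + 2) * Real.exp (-(a.re / 2) * r ^ 2)) hs
    (Eventually.of_forall fun z =>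
      (Continuous.mul (by fun_prop) (continuous_airyKernel z)).aestronglyMeasurable)
    (integrable_pow_mul_airyKernel n ha)
    (integrable_pow_mul_airyKernel (n + 2) ha).neg.aestronglyMeasurable
    (Eventually.of_forall fun r z hz => by
      rw [norm_neg, norm_pow_mul_airyKernel]
      refine mul_le_mul_of_nonneg_left (Real.exp_le_exp.2 ?_) (by positivity)
      have : a.re / 2 < z.re := hz
      nlinarith [sq_nonneg r])
    (integrable_abs_pow_mul_gaussian (n + 2) (by linarith))
    (Eventually.of_forall fun r z _ => by
      have h1 : HasDerivAt (fun z : ℂ => -z * (r : ℂ) ^ 2 - Complex.I * (r : ℂ) ^ 3 / 3)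
          (-1 * (r : ℂ) ^ 2) z :=
        (((hasDerivAt_id z).neg).mul_const _).sub_const _
      refine (h1.cexp.const_mul ((r : ℂ) ^ n)).congr_deriv ?_
      rw [airyKernel]; ring)
  have h2 := key.2
  rw [integral_neg] at h2
  exact h2

lemma hasDerivAt_airyKernel (a : ℂ) (r : ℝ) :
    HasDerivAt (airyKernel a) ((-2 * a * r - Complex.I * r ^ 2) * airyKernel a r) r := by
  have hr : HasDerivAt (fun r : ℝ => (r : ℂ)) 1 r := Complex.ofRealCLM.hasDerivAt
  have h : HasDerivAt (fun r : ℝ => -a * (r : ℂ) ^ 2 - Complex.I * (r : ℂ) ^ 3 / 3)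
      (-2 * a * r - Complex.I * r ^ 2) r := by
    refine (((hr.pow 2).const_mul (-a)).sub
      (((hr.pow 3).const_mul Complex.I).div_const 3)).congr_deriv ?_
    push_cast
    ring
  refine h.cexp.congr_deriv ?_
  rw [airyKernel]
  ring

/-- Integration by parts: the integral of the derivative of `rⁿ⁺¹ e^{-a r² - i r³/3}` vanishes. -/
lemma airyMoment_recurrence (n : ℕ) {a : ℂ} (ha : 0 < a.re) :
    (n + 1) * airyMoment n a = 2 * a * airyMoment (n + 2) a + Complex.I * airyMoment (n + 3) a := by
  have i0 : Integrable fun r : ℝ => ((n : ℂ) + 1) * ((r : ℂ) ^ n * airyKernel a r) :=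
    (integrable_pow_mul_airyKernel n ha).const_mul _
  have i1 : Integrable fun r : ℝ => 2 * a * ((r : ℂ) ^ (n + 2) * airyKernel a r) :=
    (integrable_pow_mul_airyKernel (n + 2) ha).const_mul _
  have i2 : Integrable fun r : ℝ => Complex.I * ((r : ℂ) ^ (n + 3) * airyKernel a r) :=
    (integrable_pow_mul_airyKernel (n + 3) ha).const_mul _
  have i01 : Integrable fun r : ℝ => ((n : ℂ) + 1) * ((r : ℂ) ^ n * airyKernel a r)
      - 2 * a * ((r : ℂ) ^ (n + 2) * airyKernel a r) := i0.sub i1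
  have h := integral_eq_zero_of_hasDerivAt_of_integrable (E := ℂ)
    (f := fun r : ℝ => (r : ℂ) ^ (n + 1) * airyKernel a r)
    (f' := fun r : ℝ => (n + 1) * ((r : ℂ) ^ n * airyKernel a r)
      - 2 * a * ((r : ℂ) ^ (n + 2) * airyKernel a r)
      - Complex.I * ((r : ℂ) ^ (n + 3) * airyKernel a r))
    (fun r => by
      have hr : HasDerivAt (fun r : ℝ => (r : ℂ)) 1 r := Complex.ofRealCLM.hasDerivAt
      refine ((hr.pow (n + 1)).mul (hasDerivAt_airyKernel a r)).congr_deriv ?_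
      push_cast
      simp only [Pi.pow_apply]
      ring)
    (i01.sub i2) (integrable_pow_mul_airyKernel (n + 1) ha)
  rw [integral_sub i01 i2, integral_sub i0 i1, integral_const_mul, integral_const_mul,
    integral_const_mul] at h
  simp only [airyMoment]
  linear_combination h

/-- Integration by parts for `e^{-a r² - i r³/3}` itself. -/
lemma airyMoment_one {a : ℂ} (ha : 0 < a.re) :
    2 * a * airyMoment 1 a + Complex.I * airyMoment 2 a = 0 := by
  have h := integral_eq_zero_of_hasDerivAt_of_integrable (E := ℂ)
    (f := fun r : ℝ => (r : ℂ) ^ 0 * airyKernel a r)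
    (f' := fun r : ℝ => -(2 * a * ((r : ℂ) ^ 1 * airyKernel a r)
      + Complex.I * ((r : ℂ) ^ 2 * airyKernel a r)))
    (fun r => by
      simp only [pow_zero, one_mul]
      refine (hasDerivAt_airyKernel a r).congr_deriv ?_
      ring)
    ((((integrable_pow_mul_airyKernel 1 ha).const_mul _).add
      ((integrable_pow_mul_airyKernel 2 ha).const_mul _)).neg)
    (integrable_pow_mul_airyKernel 0 ha)
  rw [integral_neg, integral_add ((integrable_pow_mul_airyKernel 1 ha).const_mul _)
      ((integrable_pow_mul_airyKernel 2 ha).const_mul _),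
    integral_const_mul, integral_const_mul] at h
  simp only [airyMoment]
  linear_combination -h

/-! ### Asymptotics of the moments -/

/-- The absolute moments `∫ |t|ᵐ e^{-t²/2} dt`. -/
noncomputable def gaussianAbsMoment (m : ℕ) : ℝ := ∫ t : ℝ, |t| ^ m * Real.exp (-(1 / 2) * t ^ 2)

lemma gaussianAbsMoment_nonneg (m : ℕ) : 0 ≤ gaussianAbsMoment m :=
  integral_nonneg fun t => by positivity

lemma integral_abs_pow_mul_gaussian_scaled (m : ℕ) {n : ℝ} (hn : 0 < n) :
    ∫ r : ℝ, |r| ^ m * Real.exp (-(n ^ 2 / 2) * r ^ 2) = gaussianAbsMoment m / n ^ (m + 1) := by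
  have h := Measure.integral_comp_mul_left
    (fun t : ℝ => |t| ^ m * Real.exp (-(1 / 2) * t ^ 2)) n
  have h2 : ∀ r : ℝ, |n * r| ^ m * Real.exp (-(1 / 2) * (n * r) ^ 2)
      = n ^ m * (|r| ^ m * Real.exp (-(n ^ 2 / 2) * r ^ 2)) := fun r => by
    rw [abs_mul, abs_of_pos hn, mul_pow, mul_assoc]
    congr 3
    ring
  simp only [h2] at h
  rw [integral_const_mul, abs_of_pos (inv_pos.2 hn), smul_eq_mul] at h
  rw [gaussianAbsMoment, pow_succ, eq_div_iff (by positivity)]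
  calc _ = (n ^ m * ∫ r : ℝ, |r| ^ m * Real.exp (-(n ^ 2 / 2) * r ^ 2)) * n := by ring_nf
    _ = _ := by rw [h]; field_simp

/-- The bound behind all moment estimates: a dominating function `C |r|ᵐ e^{-Re a r²}`, with
`n = |a|^{1/2}` and `Re a ≥ |a|/2`. -/
lemma norm_integral_le_gaussianAbsMoment (m : ℕ) {a : ℂ} {n C : ℝ} (hn : 0 < n) (hC : 0 ≤ C)
    (ha : n ^ 2 / 2 ≤ a.re) {f : ℝ → ℂ}
    (hf : ∀ r, ‖f r‖ ≤ C * (|r| ^ m * Real.exp (-a.re * r ^ 2))) :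
    ‖∫ r, f r‖ ≤ C * (gaussianAbsMoment m / n ^ (m + 1)) := by
  rw [← integral_abs_pow_mul_gaussian_scaled m hn, ← integral_const_mul]
  refine norm_integral_le_of_norm_le
    ((integrable_abs_pow_mul_gaussian m (by positivity)).const_mul _)
    (Eventually.of_forall fun r => (hf r).trans ?_)
  refine mul_le_mul_of_nonneg_left (mul_le_mul_of_nonneg_left (Real.exp_le_exp.2 ?_)
    (by positivity)) hC
  nlinarith [sq_nonneg r]

lemma norm_airyMoment_zero_le {a : ℂ} {n : ℝ} (hn : 0 < n) (ha : n ^ 2 / 2 ≤ a.re) :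
    ‖airyMoment 0 a‖ ≤ gaussianAbsMoment 0 / n := by
  have h := norm_integral_le_gaussianAbsMoment 0 hn zero_le_one ha
    (f := fun r : ℝ => (r : ℂ) ^ 0 * airyKernel a r)
    (fun r => by rw [norm_pow_mul_airyKernel, one_mul])
  simpa [airyMoment] using h

lemma norm_pow_mul_airyKernel_sub_le (m : ℕ) (a : ℂ) (r : ℝ) :
    ‖(r : ℂ) ^ m * airyKernel a r - (r : ℂ) ^ m * Complex.exp (-a * (r : ℂ) ^ 2)‖
      ≤ 1 / 3 * (|r| ^ (m + 3) * Real.exp (-a.re * r ^ 2)) := by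
  have h : (r : ℂ) ^ m * airyKernel a r - (r : ℂ) ^ m * Complex.exp (-a * (r : ℂ) ^ 2)
      = (r : ℂ) ^ m * (Complex.exp (-a * ((r ^ 2 : ℝ) : ℂ))
        * (Complex.exp (Complex.I * ((-(r ^ 3 / 3) : ℝ) : ℂ)) - 1)) := by
    rw [mul_sub, ← Complex.exp_add, airyKernel, ← mul_sub, mul_one]
    congr 3
    · push_cast; ring
    · push_cast; ring_nf
  rw [h, norm_mul, norm_mul, Complex.norm_exp, norm_pow, Complex.norm_real, Real.norm_eq_abs]
  have h1 : (-a * ((r ^ 2 : ℝ) : ℂ)).re = -a.re * r ^ 2 := by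
    rw [Complex.mul_re]
    simp only [Complex.ofReal_im, Complex.ofReal_re, Complex.neg_re]
    ring
  have h2 := Real.norm_exp_I_mul_ofReal_sub_one_le (x := -(r ^ 3 / 3))
  have h3 : ‖-(r ^ 3 / 3)‖ = |r| ^ 3 / 3 := by
    rw [norm_neg, Real.norm_eq_abs, abs_div, abs_pow, Nat.abs_ofNat]
  rw [h3] at h2
  rw [h1]
  calc _ ≤ |r| ^ m * (Real.exp (-a.re * r ^ 2) * (|r| ^ 3 / 3)) := by gcongr
    _ = _ := by ring

lemma integrable_pow_mul_cexp_gaussian (m : ℕ) {a : ℂ} (ha : 0 < a.re) :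
    Integrable fun r : ℝ => (r : ℂ) ^ m * Complex.exp (-a * (r : ℂ) ^ 2) := by
  refine (integrable_abs_pow_mul_gaussian m ha).mono'
    (Continuous.aestronglyMeasurable (by fun_prop)) (Eventually.of_forall fun r => ?_)
  rw [norm_mul, Complex.norm_exp, norm_pow, Complex.norm_real, Real.norm_eq_abs]
  have h1 : (-a * (r : ℂ) ^ 2).re = -a.re * r ^ 2 := by
    rw [← Complex.ofReal_pow, Complex.mul_re]
    simp only [Complex.ofReal_im, Complex.ofReal_re, Complex.neg_re]
    ring
  rw [h1]

lemma norm_airyMoment_sub_gaussian_le (m : ℕ) {a : ℂ} {n : ℝ} (hn : 0 < n)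
    (ha : n ^ 2 / 2 ≤ a.re) :
    ‖airyMoment m a - ∫ r : ℝ, (r : ℂ) ^ m * Complex.exp (-a * (r : ℂ) ^ 2)‖
      ≤ 1 / 3 * (gaussianAbsMoment (m + 3) / n ^ (m + 4)) := by
  have ha' : 0 < a.re := lt_of_lt_of_le (by positivity) ha
  rw [airyMoment, ← integral_sub (integrable_pow_mul_airyKernel m ha')
    (integrable_pow_mul_cexp_gaussian m ha')]
  exact norm_integral_le_gaussianAbsMoment (m + 3) hn (by norm_num) ha
    (norm_pow_mul_airyKernel_sub_le m a)

/-- The third moment is small since the odd moments of the Gaussian vanish. -/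
lemma norm_airyMoment_three_le {a : ℂ} {n : ℝ} (hn : 0 < n) (ha : n ^ 2 / 2 ≤ a.re) :
    ‖airyMoment 3 a‖ ≤ 1 / 3 * (gaussianAbsMoment 6 / n ^ 7) := by
  have h := norm_airyMoment_sub_gaussian_le 3 hn ha
  have h0 : ∫ r : ℝ, (r : ℂ) ^ 3 * Complex.exp (-a * (r : ℂ) ^ 2) = 0 := by
    have h1 := integral_neg_eq_self
      (fun r : ℝ => (r : ℂ) ^ 3 * Complex.exp (-a * (r : ℂ) ^ 2)) volume
    have h2 : ∀ r : ℝ, ((-r : ℝ) : ℂ) ^ 3 * Complex.exp (-a * ((-r : ℝ) : ℂ) ^ 2)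
        = -((r : ℂ) ^ 3 * Complex.exp (-a * (r : ℂ) ^ 2)) := fun r => by
      push_cast
      rw [neg_sq]
      ring
    simp only [h2] at h1
    rw [integral_neg] at h1
    exact self_eq_neg.1 h1.symm
  rwa [h0, sub_zero] at h

lemma le_norm_airyMoment_zero {a : ℂ} {n : ℝ} (hn : 0 < n) (ha : n ^ 2 / 2 ≤ a.re)
    (hna : ‖a‖ = n ^ 2) (hK : gaussianAbsMoment 3 ≤ n ^ 3) : 1 / n ≤ ‖airyMoment 0 a‖ := by
  have ha' : 0 < a.re := lt_of_lt_of_le (by positivity) ha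
  have h := norm_airyMoment_sub_gaussian_le 0 hn ha
  simp only [pow_zero, one_mul, zero_add] at h
  set g : ℂ := ∫ r : ℝ, Complex.exp (-a * (r : ℂ) ^ 2) with hg
  have hg2 : (‖g‖ * n) ^ 2 = Real.pi := by
    have := congrArg norm (integral_gaussian_sq_complex ha')
    rw [norm_pow, norm_div, hna, Complex.norm_real, Real.norm_eq_abs, abs_of_pos Real.pi_pos] at this
    rw [mul_pow, hg, this]
    field_simp
  have hg3 : 5 / 3 ≤ ‖g‖ * n := by
    have := Real.pi_gt_three
    have h0 : 0 ≤ ‖g‖ * n := by positivity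
    nlinarith
  have h4 : gaussianAbsMoment 3 / n ^ 4 ≤ 1 / n := by
    rw [div_le_div_iff₀ (by positivity) hn]
    nlinarith
  have h5 : 5 / 3 * (1 / n) ≤ ‖g‖ := by
    rw [mul_one_div, div_le_iff₀ hn]; exact hg3
  have h6 := norm_sub_norm_le g (airyMoment 0 a)
  rw [norm_sub_rev] at h6
  have h7 : 0 < 1 / n := by positivity
  linarith

/-- The ratio of the third and the zeroth moment is `O(|a|⁻³)` in the sector `Re a ≥ |a|/2`. -/
lemma norm_airyMoment_ratio_le {a : ℂ} {n : ℝ} (hn : 0 < n) (ha : n ^ 2 / 2 ≤ a.re)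
    (hna : ‖a‖ = n ^ 2) (hK : gaussianAbsMoment 3 ≤ n ^ 3) :
    ‖airyMoment 3 a / airyMoment 0 a‖ ≤ gaussianAbsMoment 6 / ‖a‖ ^ 3 := by
  have h0 := le_norm_airyMoment_zero hn ha hna hK
  have h3 := norm_airyMoment_three_le hn ha
  have hpos : 0 < 1 / n := by positivity
  rw [norm_div, hna, div_le_iff₀ (hpos.trans_le h0)]
  have hK6 := gaussianAbsMoment_nonneg 6
  calc ‖airyMoment 3 a‖ ≤ 1 / 3 * (gaussianAbsMoment 6 / n ^ 7) := h3
    _ ≤ gaussianAbsMoment 6 / n ^ 7 := by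
      have : 0 ≤ gaussianAbsMoment 6 / n ^ 7 := by positivity
      linarith
    _ = gaussianAbsMoment 6 / (n ^ 2) ^ 3 * (1 / n) := by field_simp
    _ ≤ _ := by gcongr

/-- The sector in which the quadratic part of the exponent controls the integrals, at a distance
from the origin at which the Gaussian approximation of the zeroth moment is effective. -/
def InAirySector (a : ℂ) : Prop :=
  0 < ‖a‖ ∧ ‖a‖ / 2 ≤ a.re ∧ gaussianAbsMoment 3 ^ 2 ≤ ‖a‖ ^ 3

lemma InAirySector.re_pos {a : ℂ} (h : InAirySector a) : 0 < a.re := by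
  have := h.1; have := h.2.1; linarith

lemma InAirySector.mul_real {a : ℂ} (h : InAirySector a) {w : ℝ} (hw : 1 ≤ w) :
    InAirySector (a * w) := by
  obtain ⟨h0, h1, h2⟩ := h
  have hw0 : 0 < w := by linarith
  have hn : ‖a * (w : ℂ)‖ = ‖a‖ * w := by
    rw [norm_mul, Complex.norm_real, Real.norm_eq_abs, abs_of_pos hw0]
  refine ⟨by rw [hn]; positivity, ?_, ?_⟩
  · rw [hn, Complex.re_mul_ofReal]
    nlinarith
  · rw [hn, mul_pow]
    refine h2.trans (le_mul_of_one_le_right (by positivity) (one_le_pow₀ hw))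

lemma InAirySector.sqrt_bounds {a : ℂ} (h : InAirySector a) :
    0 < √‖a‖ ∧ √‖a‖ ^ 2 / 2 ≤ a.re ∧ ‖a‖ = √‖a‖ ^ 2 ∧ gaussianAbsMoment 3 ≤ √‖a‖ ^ 3 := by
  obtain ⟨h0, h1, h2⟩ := h
  have hs : √‖a‖ ^ 2 = ‖a‖ := Real.sq_sqrt h0.le
  refine ⟨Real.sqrt_pos.2 h0, by rw [hs]; exact h1, hs.symm, ?_⟩
  refine le_of_sq_le_sq ?_ (by positivity)
  calc _ ≤ ‖a‖ ^ 3 := h2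
    _ = _ := by rw [← hs]; simp only [Real.sqrt_sq, Real.sqrt_nonneg]; ring

lemma InAirySector.norm_moment_le {a : ℂ} (h : InAirySector a) :
    ‖airyMoment 0 a‖ ≤ gaussianAbsMoment 0 / √‖a‖ :=
  norm_airyMoment_zero_le h.sqrt_bounds.1 h.sqrt_bounds.2.1

lemma InAirySector.le_norm_moment {a : ℂ} (h : InAirySector a) :
    1 / √‖a‖ ≤ ‖airyMoment 0 a‖ :=
  le_norm_airyMoment_zero h.sqrt_bounds.1 h.sqrt_bounds.2.1 h.sqrt_bounds.2.2.1
    h.sqrt_bounds.2.2.2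

lemma InAirySector.moment_ne_zero {a : ℂ} (h : InAirySector a) : airyMoment 0 a ≠ 0 := by
  have h0 := h.sqrt_bounds.1
  exact norm_pos_iff.1 (lt_of_lt_of_le (by positivity) h.le_norm_moment)

lemma InAirySector.ratio_le {a : ℂ} (h : InAirySector a) :
    ‖airyMoment 3 a / airyMoment 0 a‖ ≤ gaussianAbsMoment 6 / ‖a‖ ^ 3 :=
  norm_airyMoment_ratio_le h.sqrt_bounds.1 h.sqrt_bounds.2.1 h.sqrt_bounds.2.2.1
    h.sqrt_bounds.2.2.2

/-! ### The Airy profile and the ramp equation on the half-line -/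

/-- The function `e^{-2a³/3} ∫ e^{-a r² - i r³/3} dr`, a constant multiple of `Ai(a²)`. -/
noncomputable def airyProfile (a : ℂ) : ℂ := Complex.exp (-(2 / 3) * a ^ 3) * airyMoment 0 a

/-- The derivative of `airyProfile`. -/
noncomputable def airyProfileDeriv (a : ℂ) : ℂ :=
  Complex.exp (-(2 / 3) * a ^ 3) * (-airyMoment 2 a - 2 * a ^ 2 * airyMoment 0 a)

lemma hasDerivAt_cexp_cubic (a : ℂ) :
    HasDerivAt (fun a : ℂ => Complex.exp (-(2 / 3) * a ^ 3))
      (Complex.exp (-(2 / 3) * a ^ 3) * (-2 * a ^ 2)) a := by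
  have h : HasDerivAt (fun a : ℂ => -(2 / 3) * a ^ 3) (-2 * a ^ 2) a :=
    ((hasDerivAt_pow 3 a).const_mul (-(2 / 3) : ℂ)).congr_deriv (by push_cast; ring)
  exact h.cexp

lemma hasDerivAt_airyProfile {a : ℂ} (ha : 0 < a.re) :
    HasDerivAt airyProfile (airyProfileDeriv a) a := by
  refine ((hasDerivAt_cexp_cubic a).mul (hasDerivAt_airyMoment 0 ha)).congr_deriv ?_
  rw [airyProfileDeriv]
  ring

/-- In the variable `a²` this is Airy's equation. -/
lemma hasDerivAt_airyProfileDeriv {a : ℂ} (ha : 0 < a.re) :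
    HasDerivAt airyProfileDeriv (airyProfileDeriv a / a + 4 * a ^ 4 * airyProfile a) a := by
  have ha0 : a ≠ 0 := fun h => by simp [h] at ha
  have hq : HasDerivAt (fun a : ℂ => 2 * a ^ 2) (4 * a) a :=
    ((hasDerivAt_pow 2 a).const_mul (2 : ℂ)).congr_deriv (by push_cast; ring)
  have h := (hasDerivAt_cexp_cubic a).mul
    ((hasDerivAt_airyMoment 2 ha).neg.sub (hq.mul (hasDerivAt_airyMoment 0 ha)))
  refine h.congr_deriv ?_
  simp only [Pi.sub_apply, Pi.neg_apply, Pi.mul_apply, airyProfileDeriv, airyProfile]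
  have r0 := airyMoment_recurrence 0 ha
  have r1 := airyMoment_recurrence 1 ha
  have r2 := airyMoment_one ha
  norm_num at r0 r1
  have hI := Complex.I_sq
  have h4 : airyMoment 4 a = -airyMoment 2 a / a + 2 * a * airyMoment 0 a
      - 4 * a ^ 2 * airyMoment 2 a := by
    field_simp
    linear_combination Complex.I * a * r1 - Complex.I * r2 - 2 * a ^ 2 * r0
      + (a * airyMoment 4 a + airyMoment 2 a) * hI
  rw [show 2 + 2 = 4 from rfl, show 0 + 2 = 2 from rfl, h4]
  field_simp
  ring

/-- For `b⁶θ² = -k²` the function `Ai(b²(1 + θx))` normalised by its value at `0`, which solves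
`u'' + k²(1 + θx)u = 0` on `x > -1/θ`. -/
noncomputable def rampProfile (θ : ℝ) (b : ℂ) (x : ℝ) : ℂ :=
  airyProfile (b * (√(1 + θ * x) : ℂ)) / airyProfile b

/-- The derivative of `rampProfile`. -/
noncomputable def rampProfileDeriv (θ : ℝ) (b : ℂ) (x : ℝ) : ℂ :=
  airyProfileDeriv (b * (√(1 + θ * x) : ℂ)) * (b * (θ / (2 * √(1 + θ * x)))) / airyProfile b

/-- The logarithmic derivative at `0` of the half-line solution. -/
noncomputable def rampSlope (θ : ℝ) (b : ℂ) : ℂ :=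
  airyProfileDeriv b * (b * (θ / 2)) / airyProfile b

lemma hasDerivAt_sqrt_ramp {θ x : ℝ} (h : 0 < 1 + θ * x) :
    HasDerivAt (fun x : ℝ => (√(1 + θ * x) : ℂ)) ((θ : ℂ) / (2 * √(1 + θ * x))) x := by
  have h1 : HasDerivAt (fun x : ℝ => 1 + θ * x) θ x := by
    simpa using ((hasDerivAt_id x).const_mul θ).const_add 1
  have h2 := (h1.sqrt h.ne').ofReal_comp
  push_cast at h2
  exact h2

lemma hasDerivAt_rampProfile {θ x : ℝ} {b : ℂ} (hb : 0 < b.re) (h : 0 < 1 + θ * x) :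
    HasDerivAt (rampProfile θ b) (rampProfileDeriv θ b x) x := by
  have hs : 0 < √(1 + θ * x) := Real.sqrt_pos.2 h
  have ha : 0 < (b * (√(1 + θ * x) : ℂ)).re := by
    rw [Complex.re_mul_ofReal]; positivity
  exact ((hasDerivAt_airyProfile ha).comp_of_eq x ((hasDerivAt_sqrt_ramp h).const_mul b)
    rfl).div_const _

lemma hasDerivAt_rampProfileDeriv {θ x : ℝ} {b : ℂ} (hb : 0 < b.re) (h : 0 < 1 + θ * x) :
    HasDerivAt (rampProfileDeriv θ b)
      ((b ^ 3) ^ 2 * θ ^ 2 * (1 + θ * x : ℝ) * rampProfile θ b x) x := by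
  have hs : 0 < √(1 + θ * x) := Real.sqrt_pos.2 h
  have ha : 0 < (b * (√(1 + θ * x) : ℂ)).re := by
    rw [Complex.re_mul_ofReal]; positivity
  have hb0 : b ≠ 0 := fun h => by simp [h] at hb
  have hs0 : (√(1 + θ * x) : ℂ) ≠ 0 := by exact_mod_cast hs.ne'
  have hd := hasDerivAt_sqrt_ramp h
  have h1 := (hasDerivAt_airyProfileDeriv ha).comp_of_eq x (hd.const_mul b) rfl
  have h2 : HasDerivAt (fun x : ℝ => b * ((θ : ℂ) / (2 * √(1 + θ * x)))) _ x :=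
    (((hasDerivAt_const x (θ : ℂ)).div (hd.const_mul 2) (by simpa using hs.ne')).const_mul b)
  refine ((h1.mul h2).div_const (airyProfile b)).congr_deriv ?_
  have hsq : ((1 + θ * x : ℝ) : ℂ) = (√(1 + θ * x) : ℂ) ^ 2 := by
    rw [← Complex.ofReal_pow, Real.sq_sqrt h.le]
  rw [hsq, rampProfile]
  simp only [Function.comp]
  generalize (√(1 + θ * x) : ℂ) = s at hs0 ⊢
  generalize airyProfileDeriv (b * s) = G1
  generalize airyProfile (b * s) = G0
  field_simp
  ring

lemma airyProfile_ne_zero {b : ℂ} (hb : InAirySector b) : airyProfile b ≠ 0 :=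
  mul_ne_zero (Complex.exp_ne_zero _) hb.moment_ne_zero

lemma rampProfile_zero (θ : ℝ) {b : ℂ} (hb : InAirySector b) : rampProfile θ b 0 = 1 := by
  simp [rampProfile, div_self (airyProfile_ne_zero hb)]

lemma rampProfileDeriv_zero (θ : ℝ) (b : ℂ) : rampProfileDeriv θ b 0 = rampSlope θ b := by
  simp [rampProfileDeriv, rampSlope]

/-- The two-term WKB expansion of the logarithmic derivative, with an exact remainder. -/
lemma rampSlope_eq (θ : ℝ) {b : ℂ} (hb : InAirySector b) :
    rampSlope θ b = -b ^ 3 * θ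
      - θ / 4 * (1 - Complex.I * (airyMoment 3 b / airyMoment 0 b)) := by
  have h0 := hb.moment_ne_zero
  have he := Complex.exp_ne_zero (-(2 / 3) * b ^ 3)
  have r0 := airyMoment_recurrence 0 hb.re_pos
  norm_num at r0
  rw [rampSlope, airyProfileDeriv, airyProfile]
  field_simp
  linear_combination 2 * r0 * θ

lemma norm_airyProfile_mul_real (b : ℂ) (w : ℝ) :
    ‖airyProfile (b * w)‖
      = Real.exp (-(2 / 3) * (b ^ 3).re * w ^ 3) * ‖airyMoment 0 (b * w)‖ := by
  rw [airyProfile, norm_mul, Complex.norm_exp]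
  congr 2
  have : -(2 / 3) * (b * (w : ℂ)) ^ 3 = ((-(2 / 3) * w ^ 3 : ℝ) : ℂ) * b ^ 3 := by
    push_cast; ring
  rw [this, Complex.re_ofReal_mul]
  ring

lemma tendsto_sqrt_ramp {θ : ℝ} (hθ : 0 < θ) :
    Tendsto (fun x : ℝ => √(1 + θ * x)) atTop atTop :=
  Real.tendsto_sqrt_atTop.comp
    (tendsto_atTop_add_const_left _ 1 (tendsto_id.const_mul_atTop hθ))

lemma one_le_sqrt_ramp {θ x : ℝ} (hθ : 0 < θ) (hx : 0 ≤ x) : 1 ≤ √(1 + θ * x) := by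
  rw [Real.one_le_sqrt]
  have := mul_nonneg hθ.le hx
  linarith

lemma tendsto_rampProfile_zero {θ : ℝ} (hθ : 0 < θ) {b : ℂ} (hb : InAirySector b)
    (hb3 : 0 < (b ^ 3).re) : Tendsto (rampProfile θ b) atTop (𝓝 0) := by
  have hn := hb.sqrt_bounds.1
  have hlim : Tendsto (fun x : ℝ => Real.exp (-(2 / 3) * (b ^ 3).re * √(1 + θ * x) ^ 3)
      * (gaussianAbsMoment 0 / √‖b‖) / ‖airyProfile b‖) atTop (𝓝 0) := by
    have h1 : Tendsto (fun x : ℝ => -(2 / 3) * (b ^ 3).re * √(1 + θ * x) ^ 3) atTop atBot :=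
      ((tendsto_pow_atTop three_ne_zero).comp (tendsto_sqrt_ramp hθ)).const_mul_atTop_of_neg
        (by linarith)
    simpa using ((Real.tendsto_exp_atBot.comp h1).mul_const _).div_const _
  refine squeeze_zero_norm' ?_ hlim
  filter_upwards [eventually_ge_atTop 0] with x hx
  have hw := one_le_sqrt_ramp hθ hx
  have hS := hb.mul_real hw
  rw [rampProfile, norm_div, norm_airyProfile_mul_real]
  gcongr
  refine hS.norm_moment_le.trans ?_
  have := gaussianAbsMoment_nonneg 0
  gcongr
  rw [norm_mul, Complex.norm_real, Real.norm_eq_abs, abs_of_pos (by linarith)]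
  exact le_mul_of_one_le_right hb.1.le hw

lemma not_tendsto_rampProfile_zero {θ : ℝ} (hθ : 0 < θ) {b : ℂ} (hb : InAirySector b)
    (hb3 : (b ^ 3).re < 0) : ¬ Tendsto (rampProfile θ b) atTop (𝓝 0) := by
  intro h
  have hn := hb.sqrt_bounds.1
  set y : ℝ := -(2 / 3) * (b ^ 3).re with hy
  have hy0 : 0 < y := by rw [hy]; linarith
  have hG : 0 < ‖airyProfile b‖ := norm_pos_iff.2 (airyProfile_ne_zero hb)
  have hc : 0 < y * (1 / √‖b‖) / ‖airyProfile b‖ := by positivity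
  refine absurd h.norm ?_
  rw [norm_zero]
  refine fun h' => hc.not_ge (ge_of_tendsto h' ?_)
  filter_upwards [eventually_ge_atTop 0] with x hx
  have hw := one_le_sqrt_ramp hθ hx
  have hS := hb.mul_real hw
  rw [rampProfile, norm_div, norm_airyProfile_mul_real, ← hy]
  refine div_le_div_of_nonneg_right ?_ hG.le
  set w := √(1 + θ * x)
  have hw0 : 0 < w := by linarith
  have hnw : √‖b * (w : ℂ)‖ ≤ √‖b‖ * w := by
    rw [norm_mul, Complex.norm_real, Real.norm_eq_abs, abs_of_pos hw0, Real.sqrt_mul hb.1.le]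
    gcongr
    rw [Real.sqrt_le_left hw0.le]
    nlinarith
  -- the exponential dominates `y w³ ≥ y w`, which absorbs the factor `w` lost in the moment
  calc y * (1 / √‖b‖) = y * w * (1 / (√‖b‖ * w)) := by field_simp
    _ ≤ Real.exp (y * w ^ 3) * ‖airyMoment 0 (b * w)‖ := by
      have h1 : y * w ≤ Real.exp (y * w ^ 3) := by
        have : w ≤ w ^ 3 := le_self_pow₀ hw three_ne_zero
        have h2 := Real.add_one_le_exp (y * w ^ 3)
        nlinarith
      have h2 : 1 / (√‖b‖ * w) ≤ ‖airyMoment 0 (b * w)‖ :=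
        (one_div_le_one_div_of_le hS.sqrt_bounds.1 hnw).trans hS.le_norm_moment
      gcongr

/-! ### The complex frequency -/

/-- The complex frequency `k = 1 + iσ`. -/
noncomputable def freq (σ : ℝ) : ℂ := 1 + Complex.I * (σ : ℂ)

lemma freq_re (σ : ℝ) : (freq σ).re = 1 := by simp [freq]

lemma freq_im (σ : ℝ) : (freq σ).im = σ := by simp [freq]

lemma freq_zero : freq 0 = 1 := by simp [freq]

lemma freq_ne_zero (σ : ℝ) : freq σ ≠ 0 := fun h => by
  have := freq_re σ
  simp [h] at this

lemma one_le_norm_freq (σ : ℝ) : 1 ≤ ‖freq σ‖ := by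
  have := Complex.re_le_norm (freq σ)
  rwa [freq_re] at this

lemma continuous_freq : Continuous freq := by unfold freq; fun_prop

/-- The cube root of `iek/θ`, for `e = ±1`, that lies in the sector `|arg| ≤ π/3`. -/
noncomputable def airyRoot (e θ σ : ℝ) : ℂ :=
  Complex.exp ((Complex.log (freq σ / θ) + e * (Real.pi / 2) * Complex.I) / 3)

lemma airyRoot_cube {e θ : ℝ} (hθ : 0 < θ) (he : e = 1 ∨ e = -1) (σ : ℝ) :
    airyRoot e θ σ ^ 3 = e * Complex.I * freq σ / θ := by
  have hk : freq σ / θ ≠ 0 := div_ne_zero (freq_ne_zero σ) (by exact_mod_cast hθ.ne')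
  have h : Complex.exp (e * (Real.pi / 2) * Complex.I) = e * Complex.I := by
    rcases he with rfl | rfl
    · simp [Complex.exp_pi_div_two_mul_I]
    · push_cast
      rw [show (-1 : ℂ) * (Real.pi / 2) * Complex.I = -(Real.pi / 2 * Complex.I) by ring,
        Complex.exp_neg, Complex.exp_pi_div_two_mul_I, Complex.inv_I]
      ring
  rw [airyRoot, ← Complex.exp_nat_mul]
  push_cast
  rw [mul_div_cancel₀ _ (three_ne_zero), Complex.exp_add, Complex.exp_log hk, h]
  ring

lemma norm_airyRoot_cube {e θ : ℝ} (hθ : 0 < θ) (he : e = 1 ∨ e = -1) (σ : ℝ) :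
    1 / θ ≤ ‖airyRoot e θ σ‖ ^ 3 := by
  have h1 : ‖(e : ℂ)‖ = 1 := by rcases he with rfl | rfl <;> simp
  rw [← norm_pow, airyRoot_cube hθ he, norm_div, norm_mul, norm_mul, h1, Complex.norm_I,
    Complex.norm_real, Real.norm_eq_abs, abs_of_pos hθ, one_mul, one_mul]
  have := one_le_norm_freq σ
  gcongr

lemma airyRoot_re {e θ : ℝ} (hθ : 0 < θ) (he : e = 1 ∨ e = -1) (σ : ℝ) :
    ‖airyRoot e θ σ‖ / 2 ≤ (airyRoot e θ σ).re := by
  rw [airyRoot, Complex.norm_exp, Complex.exp_re]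
  set z := (Complex.log (freq σ / θ) + e * (Real.pi / 2) * Complex.I) / 3 with hz
  have him : z.im = (Complex.arg (freq σ / θ) + e * (Real.pi / 2)) / 3 := by
    rw [hz, show (3 : ℂ) = ((3 : ℝ) : ℂ) by simp, Complex.div_ofReal_im, Complex.add_im,
      Complex.log_im]
    congr 2
    simp
  have harg : |Complex.arg (freq σ / θ)| ≤ Real.pi / 2 := by
    rw [Complex.abs_arg_le_pi_div_two_iff, Complex.div_ofReal_re, freq_re]
    positivity
  have hpi := Real.pi_pos
  have habs : |z.im| ≤ Real.pi / 3 := by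
    rw [him]
    rw [abs_le] at harg ⊢
    rcases he with rfl | rfl <;> constructor <;> linarith [harg.1, harg.2]
  have hcos : 1 / 2 ≤ Real.cos z.im := by
    rw [← Real.cos_pi_div_three, ← Real.cos_abs z.im]
    exact Real.cos_le_cos_of_nonneg_of_le_pi (abs_nonneg _) (by linarith) habs
  have := Real.exp_pos z.re
  nlinarith

lemma continuous_airyRoot (e : ℝ) {θ : ℝ} (hθ : 0 < θ) : Continuous (airyRoot e θ) := by
  have h : Continuous fun σ : ℝ => Complex.log (freq σ / θ) := by
    refine (continuous_freq.div_const _).clog fun σ => Or.inl ?_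
    rw [Complex.div_ofReal_re, freq_re]
    positivity
  unfold airyRoot
  fun_prop

/-- Slopes below which the perturbative estimates hold. -/
def IsSmallSlope (θ : ℝ) : Prop :=
  0 < θ ∧ θ < 1 ∧ gaussianAbsMoment 3 ^ 2 * θ ≤ 1 ∧ gaussianAbsMoment 6 * θ ≤ 1

lemma inAirySector_airyRoot {e θ : ℝ} (hθ : IsSmallSlope θ) (he : e = 1 ∨ e = -1) (σ : ℝ) :
    InAirySector (airyRoot e θ σ) := by
  refine ⟨norm_pos_iff.2 (Complex.exp_ne_zero _), airyRoot_re hθ.1 he σ, ?_⟩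
  refine le_trans ?_ (norm_airyRoot_cube hθ.1 he σ)
  rw [le_div_iff₀ hθ.1]
  exact hθ.2.2.1

lemma norm_airyRoot_ratio_le {e θ : ℝ} (hθ : IsSmallSlope θ) (he : e = 1 ∨ e = -1) (σ : ℝ) :
    ‖airyMoment 3 (airyRoot e θ σ) / airyMoment 0 (airyRoot e θ σ)‖
      ≤ gaussianAbsMoment 6 * θ := by
  refine (inAirySector_airyRoot hθ he σ).ratio_le.trans ?_
  have h := norm_airyRoot_cube hθ.1 he σ
  have h0 : 0 < 1 / θ := one_div_pos.2 hθ.1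
  have h6 := gaussianAbsMoment_nonneg 6
  calc _ ≤ gaussianAbsMoment 6 / (1 / θ) := by gcongr
    _ = _ := by simp

/-! ### The fundamental system on the whole line -/

lemma invSqSpeed_one (θ x : ℝ) : invSqSpeed 1 θ x = 1 + θ * max x 0 := by
  rw [invSqSpeed, Real.rpow_one]

/-- The function equal to `f` on `[0, ∞)` and to `g` on `(-∞, 0]`, when `f 0 = g 0`. The formula
makes continuous dependence on parameters evident. -/
noncomputable def glueAtZero (f g : ℝ → ℂ) (x : ℝ) : ℂ := f (max x 0) + g (min x 0) - f 0

lemma glueAtZero_of_nonneg {f g : ℝ → ℂ} (h : f 0 = g 0) {x : ℝ} (hx : 0 ≤ x) :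
    glueAtZero f g x = f x := by
  rw [glueAtZero, max_eq_left hx, min_eq_right hx, h]; ring

lemma glueAtZero_of_nonpos {f g : ℝ → ℂ} {x : ℝ} (hx : x ≤ 0) :
    glueAtZero f g x = g x := by
  rw [glueAtZero, max_eq_right hx, min_eq_left hx]; ring

lemma hasDerivAt_glueAtZero {f g f' g' : ℝ → ℂ} (h0 : f 0 = g 0) (h0' : f' 0 = g' 0)
    (hf : ∀ x, 0 ≤ x → HasDerivAt f (f' x) x) (hg : ∀ x, x ≤ 0 → HasDerivAt g (g' x) x) (x : ℝ) :
    HasDerivAt (glueAtZero f g) (glueAtZero f' g' x) x := by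
  rcases lt_trichotomy x 0 with hx | rfl | hx
  · rw [glueAtZero_of_nonpos hx.le]
    refine (hg x hx.le).congr_of_eventuallyEq ?_
    filter_upwards [Iio_mem_nhds hx] with y hy using glueAtZero_of_nonpos (le_of_lt hy)
  · rw [← hasDerivWithinAt_univ, ← Set.Iic_union_Ici (a := (0 : ℝ))]
    refine HasDerivWithinAt.union ?_ ?_
    · rw [glueAtZero_of_nonpos le_rfl]
      exact (hg 0 le_rfl).hasDerivWithinAt.congr (fun y hy => glueAtZero_of_nonpos hy)
        (glueAtZero_of_nonpos le_rfl)
    · rw [glueAtZero_of_nonneg h0' le_rfl]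
      exact (hf 0 le_rfl).hasDerivWithinAt.congr (fun y hy => glueAtZero_of_nonneg h0 hy)
        (glueAtZero_of_nonneg h0 le_rfl)
  · rw [glueAtZero_of_nonneg h0' hx.le]
    refine (hf x hx.le).congr_of_eventuallyEq ?_
    filter_upwards [Ioi_mem_nhds hx] with y hy using glueAtZero_of_nonneg h0 (le_of_lt hy)

/-- Gluing solutions of the equation on the two half-lines with the same Cauchy data at `0`. -/
lemma isWaveSolution_glueAtZero {θ σ : ℝ} {f g f' g' : ℝ → ℂ} (h0 : f 0 = g 0)
    (h0' : f' 0 = g' 0) (hf : ∀ x, 0 ≤ x → HasDerivAt f (f' x) x)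
    (hg : ∀ x, x ≤ 0 → HasDerivAt g (g' x) x)
    (hf' : ∀ x, 0 ≤ x → HasDerivAt f' (-(freq σ ^ 2 * (1 + θ * x : ℝ) * f x)) x)
    (hg' : ∀ x, x ≤ 0 → HasDerivAt g' (-(freq σ ^ 2 * g x)) x) :
    IsWaveSolution 1 θ σ (glueAtZero f g) ∧
      deriv (glueAtZero f g) = glueAtZero f' g' := by
  have hd := hasDerivAt_glueAtZero h0 h0' hf hg
  have hderiv : deriv (glueAtZero f g) = glueAtZero f' g' := funext fun x => (hd x).deriv
  refine ⟨⟨fun x => (hd x).differentiableAt, fun x => ?_⟩, hderiv⟩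
  rw [hderiv]
  refine (hasDerivAt_glueAtZero h0' (by simp [h0]) hf' hg' x).congr_deriv ?_
  rw [invSqSpeed_one]
  rcases le_total x 0 with hx | hx
  · rw [glueAtZero_of_nonpos hx, glueAtZero_of_nonpos hx, max_eq_right hx]
    simp [freq]
  · rw [glueAtZero_of_nonneg (by simp [h0]) hx, glueAtZero_of_nonneg h0 hx, max_eq_left hx, freq]

/-- The logarithmic derivative at `0` of the Airy solution: `e = 1` is the right-going and `e = -1`
the left-going one. -/
noncomputable def airySlope (e θ σ : ℝ) : ℂ := rampSlope θ (airyRoot e θ σ)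

/-- The relative size of the terms neglected in the two-term expansion of `airySlope`. -/
noncomputable def airyRemainder (e θ σ : ℝ) : ℂ :=
  airyMoment 3 (airyRoot e θ σ) / airyMoment 0 (airyRoot e θ σ)

lemma airySlope_eq {e θ : ℝ} (hθ : IsSmallSlope θ) (he : e = 1 ∨ e = -1) (σ : ℝ) :
    airySlope e θ σ = -(e * Complex.I * freq σ)
      - θ / 4 * (1 - Complex.I * airyRemainder e θ σ) := by
  have hθ0 : (θ : ℂ) ≠ 0 := by exact_mod_cast hθ.1.ne'
  rw [airySlope, rampSlope_eq θ (inAirySector_airyRoot hθ he σ), airyRoot_cube hθ.1 he,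
    airyRemainder]
  field_simp

/-- The two Airy solutions are independent, uniformly in `σ`. -/
lemma airySlope_sub_ne_zero {θ : ℝ} (hθ : IsSmallSlope θ) (σ : ℝ) :
    airySlope (-1) θ σ - airySlope 1 θ σ ≠ 0 := by
  intro h
  rw [airySlope_eq hθ (Or.inr rfl), airySlope_eq hθ (Or.inl rfl)] at h
  have h1 := norm_airyRoot_ratio_le hθ (Or.inl rfl : (1 : ℝ) = 1 ∨ (1 : ℝ) = -1) σ
  have h2 := norm_airyRoot_ratio_le hθ (Or.inr rfl : (-1 : ℝ) = 1 ∨ (-1 : ℝ) = -1) σ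
  rw [← airyRemainder] at h1 h2
  have h3 : 2 * freq σ = θ / 4 * (airyRemainder 1 θ σ - airyRemainder (-1) θ σ) := by
    push_cast at h
    linear_combination (-Complex.I) * h + (2 * freq σ + θ / 4 * (airyRemainder (-1) θ σ
      - airyRemainder 1 θ σ)) * Complex.I_sq
  have h4 := congrArg norm h3
  rw [norm_mul, norm_mul, norm_div, Complex.norm_real, Real.norm_eq_abs, abs_of_pos hθ.1] at h4
  have h5 := norm_sub_le (airyRemainder 1 θ σ) (airyRemainder (-1) θ σ)
  have h6 := one_le_norm_freq σ
  have h7 := hθ.2.2.2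
  have h8 := hθ.2.1
  have h9 := hθ.1
  norm_num at h4
  nlinarith [norm_nonneg (airyRemainder 1 θ σ - airyRemainder (-1) θ σ)]

/-- On `[0, ∞)`, the solution with Cauchy data `(c₀, c₁)` at `0`, in terms of a pair of functions
(the Airy solutions or their derivatives). -/
noncomputable def airyComb (θ σ : ℝ) (c₀ c₁ : ℂ) (F : ℂ → ℝ → ℂ) (x : ℝ) : ℂ :=
  ((c₀ * airySlope (-1) θ σ - c₁) * F (airyRoot 1 θ σ) x
    + (c₁ - c₀ * airySlope 1 θ σ) * F (airyRoot (-1) θ σ) x)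
    / (airySlope (-1) θ σ - airySlope 1 θ σ)

/-- On `(-∞, 0]`, the solution with Cauchy data `(c₀, c₁)` at `0`. -/
noncomputable def flatSolution (σ : ℝ) (c₀ c₁ : ℂ) (x : ℝ) : ℂ :=
  c₀ * Complex.cos (freq σ * x) + c₁ * (Complex.sin (freq σ * x) / freq σ)

/-- The derivative of `flatSolution`. -/
noncomputable def flatSolutionDeriv (σ : ℝ) (c₀ c₁ : ℂ) (x : ℝ) : ℂ :=
  -(c₀ * freq σ * Complex.sin (freq σ * x)) + c₁ * Complex.cos (freq σ * x)

/-- The solution on `ℝ` with Cauchy data `(c₀, c₁)` at `0`. -/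
noncomputable def cauchySolution (θ σ : ℝ) (c₀ c₁ : ℂ) : ℝ → ℂ :=
  glueAtZero (airyComb θ σ c₀ c₁ (rampProfile θ)) (flatSolution σ c₀ c₁)

lemma hasDerivAt_freq_mul (σ x : ℝ) : HasDerivAt (fun x : ℝ => freq σ * (x : ℂ)) (freq σ) x := by
  simpa using (Complex.ofRealCLM.hasDerivAt (x := x)).const_mul (freq σ)

lemma hasDerivAt_flatSolution (σ : ℝ) (c₀ c₁ : ℂ) (x : ℝ) :
    HasDerivAt (flatSolution σ c₀ c₁) (flatSolutionDeriv σ c₀ c₁ x) x := by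
  have h := hasDerivAt_freq_mul σ x
  refine ((((Complex.hasDerivAt_cos _).comp x h).const_mul c₀).add
    ((((Complex.hasDerivAt_sin _).comp x h).div_const (freq σ)).const_mul c₁)).congr_deriv ?_
  have := freq_ne_zero σ
  rw [flatSolutionDeriv]
  field_simp

lemma hasDerivAt_flatSolutionDeriv (σ : ℝ) (c₀ c₁ : ℂ) (x : ℝ) :
    HasDerivAt (flatSolutionDeriv σ c₀ c₁) (-(freq σ ^ 2 * flatSolution σ c₀ c₁ x)) x := by
  have h := hasDerivAt_freq_mul σ x
  refine ((((Complex.hasDerivAt_sin _).comp x h).const_mul (c₀ * freq σ)).neg.add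
    (((Complex.hasDerivAt_cos _).comp x h).const_mul c₁)).congr_deriv ?_
  have := freq_ne_zero σ
  rw [flatSolution]
  field_simp
  ring

lemma hasDerivAt_airyComb {θ σ x : ℝ} (c₀ c₁ : ℂ) {F F' : ℂ → ℝ → ℂ}
    (h1 : HasDerivAt (F (airyRoot 1 θ σ)) (F' (airyRoot 1 θ σ) x) x)
    (h2 : HasDerivAt (F (airyRoot (-1) θ σ)) (F' (airyRoot (-1) θ σ) x) x) :
    HasDerivAt (airyComb θ σ c₀ c₁ F) (airyComb θ σ c₀ c₁ F' x) x :=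
  ((h1.const_mul _).add (h2.const_mul _)).div_const _

lemma airyComb_rampProfile_zero {θ : ℝ} (hθ : IsSmallSlope θ) (σ : ℝ) (c₀ c₁ : ℂ) :
    airyComb θ σ c₀ c₁ (rampProfile θ) 0 = c₀ := by
  have h := airySlope_sub_ne_zero hθ σ
  rw [airyComb, rampProfile_zero θ (inAirySector_airyRoot hθ (Or.inl rfl) σ),
    rampProfile_zero θ (inAirySector_airyRoot hθ (Or.inr rfl) σ), div_eq_iff h]
  ring

lemma isWaveSolution_cauchySolution_and_deriv {θ : ℝ} (hθ : IsSmallSlope θ) (σ : ℝ) (c₀ c₁ : ℂ) :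
    IsWaveSolution 1 θ σ (cauchySolution θ σ c₀ c₁) ∧
      deriv (cauchySolution θ σ c₀ c₁) = glueAtZero
        (airyComb θ σ c₀ c₁ (rampProfileDeriv θ)) (flatSolutionDeriv σ c₀ c₁) := by
  have hS1 := inAirySector_airyRoot hθ (Or.inl rfl : (1 : ℝ) = 1 ∨ (1 : ℝ) = -1) σ
  have hS2 := inAirySector_airyRoot hθ (Or.inr rfl : (-1 : ℝ) = 1 ∨ (-1 : ℝ) = -1) σ
  have hpos : ∀ x : ℝ, 0 ≤ x → 0 < 1 + θ * x := fun x hx => by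
    have := mul_nonneg hθ.1.le hx
    linarith
  refine isWaveSolution_glueAtZero ?_ ?_ (fun x hx => ?_) (fun x _ => ?_) (fun x hx => ?_)
    (fun x _ => ?_)
  · rw [airyComb_rampProfile_zero hθ]
    simp [flatSolution]
  · have h := airySlope_sub_ne_zero hθ σ
    rw [airyComb, rampProfileDeriv_zero, rampProfileDeriv_zero, ← airySlope, ← airySlope]
    simp only [flatSolutionDeriv, Complex.ofReal_zero, mul_zero, Complex.sin_zero,
      Complex.cos_zero]
    rw [div_eq_iff h]
    ring
  · exact hasDerivAt_airyComb c₀ c₁ (hasDerivAt_rampProfile hS1.re_pos (hpos x hx))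
      (hasDerivAt_rampProfile hS2.re_pos (hpos x hx))
  · exact hasDerivAt_flatSolution σ c₀ c₁ x
  · have h1 := hasDerivAt_rampProfileDeriv hS1.re_pos (hpos x hx)
    have h2 := hasDerivAt_rampProfileDeriv hS2.re_pos (hpos x hx)
    refine (hasDerivAt_airyComb c₀ c₁ (F' := fun b x =>
      (b ^ 3) ^ 2 * θ ^ 2 * (1 + θ * x : ℝ) * rampProfile θ b x) h1 h2).congr_deriv ?_
    have hθ0 : (θ : ℂ) ≠ 0 := by exact_mod_cast hθ.1.ne'
    have e1 : (airyRoot 1 θ σ ^ 3) ^ 2 * θ ^ 2 = -freq σ ^ 2 := by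
      rw [airyRoot_cube hθ.1 (Or.inl rfl)]
      field_simp
      push_cast
      linear_combination freq σ ^ 2 * Complex.I_sq
    have e2 : (airyRoot (-1) θ σ ^ 3) ^ 2 * θ ^ 2 = -freq σ ^ 2 := by
      rw [airyRoot_cube hθ.1 (Or.inr rfl)]
      field_simp
      push_cast
      linear_combination freq σ ^ 2 * Complex.I_sq
    simp only [airyComb, e1, e2]
    ring
  · exact hasDerivAt_flatSolutionDeriv σ c₀ c₁ x

lemma isWaveSolution_cauchySolution {θ : ℝ} (hθ : IsSmallSlope θ) (σ : ℝ) (c₀ c₁ : ℂ) :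
    IsWaveSolution 1 θ σ (cauchySolution θ σ c₀ c₁) :=
  (isWaveSolution_cauchySolution_and_deriv hθ σ c₀ c₁).1

lemma deriv_cauchySolution_zero {θ : ℝ} (hθ : IsSmallSlope θ) (σ : ℝ) (c₀ c₁ : ℂ) :
    deriv (cauchySolution θ σ c₀ c₁) 0 = c₁ := by
  rw [(isWaveSolution_cauchySolution_and_deriv hθ σ c₀ c₁).2, glueAtZero_of_nonpos le_rfl]
  simp [flatSolutionDeriv]

lemma cauchySolution_of_nonpos (θ σ : ℝ) (c₀ c₁ : ℂ) {x : ℝ} (hx : x ≤ 0) :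
    cauchySolution θ σ c₀ c₁ x = flatSolution σ c₀ c₁ x := glueAtZero_of_nonpos hx

lemma cauchySolution_zero (θ σ : ℝ) (c₀ c₁ : ℂ) : cauchySolution θ σ c₀ c₁ 0 = c₀ := by
  rw [cauchySolution_of_nonpos θ σ c₀ c₁ le_rfl]
  simp [flatSolution]

lemma cauchySolution_of_nonneg {θ : ℝ} (hθ : IsSmallSlope θ) (σ : ℝ) (c₀ c₁ : ℂ) {x : ℝ}
    (hx : 0 ≤ x) :
    cauchySolution θ σ c₀ c₁ x = airyComb θ σ c₀ c₁ (rampProfile θ) x :=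
  glueAtZero_of_nonneg (by rw [airyComb_rampProfile_zero hθ]; simp [flatSolution]) hx

lemma continuous_airySlope {e θ : ℝ} (hθ : IsSmallSlope θ) (he : e = 1 ∨ e = -1) :
    Continuous (airySlope e θ) := by
  refine continuous_iff_continuousAt.2 fun σ => ?_
  have hS := inAirySector_airyRoot hθ he σ
  have hc := (continuous_airyRoot e hθ.1).continuousAt (x := σ)
  have h1 := ContinuousAt.comp (f := airyRoot e θ)
    (hasDerivAt_airyProfile hS.re_pos).continuousAt hc
  have h2 := ContinuousAt.comp (f := airyRoot e θ)
    (hasDerivAt_airyProfileDeriv hS.re_pos).continuousAt hc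
  exact (h2.mul (hc.mul continuousAt_const)).div h1 (airyProfile_ne_zero hS)

lemma continuous_rampProfile_max {e θ : ℝ} (hθ : IsSmallSlope θ) (he : e = 1 ∨ e = -1) :
    Continuous fun q : ℝ × ℝ => rampProfile θ (airyRoot e θ q.1) (max q.2 0) := by
  refine continuous_iff_continuousAt.2 fun q => ?_
  have hS := inAirySector_airyRoot hθ he q.1
  have hw := one_le_sqrt_ramp hθ.1 (le_max_right q.2 0)
  have hc := continuous_airyRoot e hθ.1
  have h1 : ContinuousAt (fun q : ℝ × ℝ => airyProfile (airyRoot e θ q.1)) q :=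
    (hasDerivAt_airyProfile hS.re_pos).continuousAt.comp
      (f := fun q : ℝ × ℝ => airyRoot e θ q.1) (hc.comp continuous_fst).continuousAt
  have ha : Continuous fun q : ℝ × ℝ => airyRoot e θ q.1 * (√(1 + θ * max q.2 0) : ℂ) :=
    (hc.comp continuous_fst).mul (Complex.continuous_ofReal.comp (by fun_prop))
  have hg : ContinuousAt airyProfile (airyRoot e θ q.1 * (√(1 + θ * max q.2 0) : ℂ)) :=
    (hasDerivAt_airyProfile (hS.mul_real hw).re_pos).continuousAt
  have h2 : ContinuousAt
      (fun q : ℝ × ℝ => airyProfile (airyRoot e θ q.1 * (√(1 + θ * max q.2 0) : ℂ))) q :=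
    hg.comp_of_eq ha.continuousAt rfl
  exact h2.div h1 (airyProfile_ne_zero hS)

lemma continuous_cauchySolution {θ : ℝ} (hθ : IsSmallSlope θ) {c₀ c₁ : ℝ → ℂ}
    (h₀ : Continuous c₀) (h₁ : Continuous c₁) :
    Continuous fun q : ℝ × ℝ => cauchySolution θ q.1 (c₀ q.1) (c₁ q.1) q.2 := by
  have p1 : Continuous fun q : ℝ × ℝ => airySlope 1 θ q.1 :=
    (continuous_airySlope hθ (Or.inl rfl)).comp continuous_fst
  have p2 : Continuous fun q : ℝ × ℝ => airySlope (-1) θ q.1 :=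
    (continuous_airySlope hθ (Or.inr rfl)).comp continuous_fst
  have r1 := continuous_rampProfile_max hθ (Or.inl rfl : (1 : ℝ) = 1 ∨ (1 : ℝ) = -1)
  have r2 := continuous_rampProfile_max hθ (Or.inr rfl : (-1 : ℝ) = 1 ∨ (-1 : ℝ) = -1)
  have d₀ : Continuous fun q : ℝ × ℝ => c₀ q.1 := h₀.comp continuous_fst
  have d₁ : Continuous fun q : ℝ × ℝ => c₁ q.1 := h₁.comp continuous_fst
  have hk : Continuous fun q : ℝ × ℝ => freq q.1 := continuous_freq.comp continuous_fst
  have hm : Continuous fun q : ℝ × ℝ => freq q.1 * (min q.2 0 : ℝ) :=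
    hk.mul (Complex.continuous_ofReal.comp (continuous_snd.min continuous_const))
  have hplus : Continuous fun q : ℝ × ℝ =>
      airyComb θ q.1 (c₀ q.1) (c₁ q.1) (rampProfile θ) (max q.2 0) :=
    Continuous.div ((((d₀.mul p2).sub d₁).mul r1).add ((d₁.sub (d₀.mul p1)).mul r2))
      (p2.sub p1) fun q => airySlope_sub_ne_zero hθ q.1
  have hminus : Continuous fun q : ℝ × ℝ => flatSolution q.1 (c₀ q.1) (c₁ q.1) (min q.2 0) :=
    (d₀.mul (Complex.continuous_cos.comp hm)).add
      (d₁.mul ((Complex.continuous_sin.comp hm).div hk fun q => freq_ne_zero q.1))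
  simp only [cauchySolution, glueAtZero, airyComb_rampProfile_zero hθ]
  exact (hplus.add hminus).sub d₀

/-! ### Wronskians and polarized waves -/

/-- The Wronskian `u v' - u' v`. -/
noncomputable def wronskianAt (u v : ℝ → ℂ) (x : ℝ) : ℂ := u x * deriv v x - deriv u x * v x

lemma wronskianAt_eq {α θ σ : ℝ} {u v : ℝ → ℂ} (hu : IsWaveSolution α θ σ u)
    (hv : IsWaveSolution α θ σ v) (x : ℝ) : wronskianAt u v x = wronskianAt u v 0 := by
  have h : ∀ x, HasDerivAt (wronskianAt u v) 0 x := fun x => by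
    refine (((hu.1 x).hasDerivAt.mul (hv.2 x)).sub
      ((hu.2 x).mul (hv.1 x).hasDerivAt)).congr_deriv ?_
    ring
  exact is_const_of_deriv_eq_zero (fun x => (h x).differentiableAt) (fun x => (h x).deriv) x 0

/-- If `T` decays along `l` and an independent solution `T'` does not, then all decaying solutions
are multiples of `T`. -/
lemma eq_mul_of_tendsto_zero {α θ σ : ℝ} {l : Filter ℝ} {T T' v : ℝ → ℂ}
    (hT : IsWaveSolution α θ σ T) (hT' : IsWaveSolution α θ σ T')
    (h0 : T 0 = 1) (h0' : T' 0 = 1) (hne : deriv T 0 ≠ deriv T' 0)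
    (hlim : Tendsto T l (𝓝 0)) (hlim' : ¬ Tendsto T' l (𝓝 0))
    (hv : IsWaveSolution α θ σ v) (hvlim : Tendsto v l (𝓝 0)) (x : ℝ) : v x = v 0 * T x := by
  have key : ∀ x, v x * wronskianAt T T' 0 + T x * wronskianAt T' v 0
      + T' x * wronskianAt v T 0 = 0 := fun x => by
    rw [← wronskianAt_eq hT hT' x, ← wronskianAt_eq hT' hv x, ← wronskianAt_eq hv hT x]
    simp only [wronskianAt]
    ring
  have hw : wronskianAt v T 0 = 0 := by
    by_contra hw
    refine hlim' ?_
    have h1 : Tendsto (fun x => -(v x * wronskianAt T T' 0 + T x * wronskianAt T' v 0)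
        / wronskianAt v T 0) l (𝓝 0) := by
      simpa using (((hvlim.mul_const (wronskianAt T T' 0)).add
        (hlim.mul_const (wronskianAt T' v 0))).neg.div_const (wronskianAt v T 0))
    refine h1.congr fun x => ?_
    rw [div_eq_iff hw]
    linear_combination -key x
  have hk := key x
  rw [hw] at hk
  simp only [wronskianAt, h0, h0'] at hk hw
  have hne' : deriv T' 0 - deriv T 0 ≠ 0 := sub_ne_zero.2 hne.symm
  refine mul_right_cancel₀ hne' ?_
  linear_combination hk + T x * hw

/-- If the waves decaying along `l` are the multiples of a continuous family `T σ`, then polarized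
waves are multiples of the limit `T 0`. -/
lemma IsPolarizedWave.eq_mul {α θ : ℝ} {S : Set ℝ} {l : Filter ℝ} {T : ℝ → ℝ → ℂ} {u : ℝ → ℂ}
    (hT : Continuous fun q : ℝ × ℝ => T q.1 q.2)
    (h : ∀ σ ∈ S, ∀ v, IsWaveSolution α θ σ v → Tendsto v l (𝓝 0) → ∀ x, v x = v 0 * T σ x)
    (hu : IsPolarizedWave α θ S l u) (x : ℝ) : u x = u 0 * T 0 x := by
  obtain ⟨-, -, σ, v, hS, hσ, hv, hvl, hlim⟩ := hu
  have hpt : ∀ y, Tendsto (fun n => v n y) atTop (𝓝 (u y)) := fun y =>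
    (tendstoLocallyUniformlyOn_univ.2 hlim).tendsto_at (Set.mem_univ y)
  have hTl : Tendsto (fun n => T (σ n) x) atTop (𝓝 (T 0 x)) :=
    ((hT.comp (by fun_prop : Continuous fun s : ℝ => (s, x))).tendsto 0).comp hσ
  exact tendsto_nhds_unique (hpt x)
    (((hpt 0).mul hTl).congr fun n => (h _ (hS n) _ (hv n) (hvl n) x).symm)

lemma IsPolarizedWave.apply_zero_ne_zero {α θ : ℝ} {S : Set ℝ} {l : Filter ℝ} {f u : ℝ → ℂ}
    (hu : IsPolarizedWave α θ S l u) (h : ∀ x, u x = u 0 * f x) : u 0 ≠ 0 := fun h0 =>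
  hu.2.1 (funext fun x => by rw [h x, h0, zero_mul]; rfl)

lemma isPolarizedWave_of_family {α θ : ℝ} {S : Set ℝ} {l : Filter ℝ} {T : ℝ → ℝ → ℂ}
    (hT : Continuous fun q : ℝ × ℝ => T q.1 q.2) (hsol : ∀ σ, IsWaveSolution α θ σ (T σ))
    (hne : T 0 0 ≠ 0) (hlim : ∀ σ ∈ S, Tendsto (T σ) l (𝓝 0)) (hS : (0 : ℝ) ∈ closure S) :
    IsPolarizedWave α θ S l (T 0) := by
  obtain ⟨σ, hσS, hσ⟩ := mem_closure_iff_seq_limit.1 hS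
  refine ⟨hsol 0, fun h => hne (by rw [h]; rfl), σ, fun n => T (σ n), hσS, hσ,
    fun n => hsol _, fun n => hlim _ (hσS n), ?_⟩
  -- a jointly continuous family is continuous in `σ` for the compact-open topology
  let F : C(ℝ × ℝ, ℂ) := ⟨fun q => T q.1 q.2, hT⟩
  have h1 : Tendsto (fun n => F.curry (σ n)) atTop (𝓝 (F.curry 0)) :=
    (F.curry.continuous.tendsto 0).comp hσ
  exact ContinuousMap.tendsto_iff_tendstoLocallyUniformly.1 h1

/-! ### Outgoing and incoming waves for the ramp -/

/-- The solution equal to `1` at `0` that on `[0, ∞)` is the Airy solution of type `e`. -/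
noncomputable def rampWave (e θ σ : ℝ) : ℝ → ℂ := cauchySolution θ σ 1 (airySlope e θ σ)

/-- The solution that on `(-∞, 0]` is the plane wave `e^{iekx}`, `k = 1 + iσ`. -/
noncomputable def planeWave (e θ σ : ℝ) : ℝ → ℂ := cauchySolution θ σ 1 (e * Complex.I * freq σ)

lemma rampWave_of_nonneg {e θ : ℝ} (hθ : IsSmallSlope θ) (he : e = 1 ∨ e = -1) (σ : ℝ) {x : ℝ}
    (hx : 0 ≤ x) : rampWave e θ σ x = rampProfile θ (airyRoot e θ σ) x := by
  have h := airySlope_sub_ne_zero hθ σ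
  rw [rampWave, cauchySolution_of_nonneg hθ σ _ _ hx, airyComb, div_eq_iff h]
  rcases he with rfl | rfl <;> ring

lemma flatSolution_planeWave {e : ℝ} (he : e = 1 ∨ e = -1) (σ : ℝ) (x : ℝ) :
    flatSolution σ 1 (e * Complex.I * freq σ) x = Complex.exp (e * Complex.I * freq σ * x) := by
  have hk := freq_ne_zero σ
  have h : flatSolution σ 1 (e * Complex.I * freq σ) x
      = Complex.cos (freq σ * x) + e * Complex.sin (freq σ * x) * Complex.I := by
    rw [flatSolution]
    field_simp
  rw [h]
  rcases he with rfl | rfl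
  · rw [Complex.ofReal_one, one_mul, ← Complex.exp_mul_I]
    congr 1
    ring
  · have h1 := Complex.exp_mul_I (-(freq σ * x))
    rw [Complex.cos_neg, Complex.sin_neg] at h1
    push_cast
    rw [neg_one_mul, ← h1]
    congr 1
    ring

lemma planeWave_of_nonpos {e : ℝ} (he : e = 1 ∨ e = -1) (θ σ : ℝ) {x : ℝ} (hx : x ≤ 0) :
    planeWave e θ σ x = Complex.exp (e * Complex.I * freq σ * x) := by
  rw [planeWave, cauchySolution_of_nonpos θ σ _ _ hx, flatSolution_planeWave he]

lemma norm_planeWave_of_nonpos {e : ℝ} (he : e = 1 ∨ e = -1) (θ σ : ℝ) {x : ℝ} (hx : x ≤ 0) :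
    ‖planeWave e θ σ x‖ = Real.exp (-(e * σ) * x) := by
  rw [planeWave_of_nonpos he θ σ hx, Complex.norm_exp]
  congr 1
  have : (e : ℂ) * Complex.I * freq σ * x = ((e * x : ℝ) : ℂ) * (Complex.I * freq σ) := by
    push_cast; ring
  rw [this, Complex.re_ofReal_mul, Complex.I_mul_re, freq_im]
  ring

lemma tendsto_planeWave {e : ℝ} (he : e = 1 ∨ e = -1) (θ : ℝ) {σ : ℝ} (h : e * σ < 0) :
    Tendsto (planeWave e θ σ) atBot (𝓝 0) := by
  have h1 : Tendsto (fun x : ℝ => Real.exp (-(e * σ) * x)) atBot (𝓝 0) :=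
    Real.tendsto_exp_atBot.comp (tendsto_id.const_mul_atBot (by linarith))
  refine squeeze_zero_norm' ?_ h1
  filter_upwards [eventually_le_atBot 0] with x hx using (norm_planeWave_of_nonpos he θ σ hx).le

lemma not_tendsto_planeWave {e : ℝ} (he : e = 1 ∨ e = -1) (θ : ℝ) {σ : ℝ} (h : 0 < e * σ) :
    ¬ Tendsto (planeWave e θ σ) atBot (𝓝 0) := by
  intro h'
  have h1 := h'.norm
  rw [norm_zero] at h1
  refine absurd (ge_of_tendsto (b := (1 : ℝ)) h1 ?_) (by norm_num)
  filter_upwards [eventually_le_atBot 0] with x hx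
  rw [norm_planeWave_of_nonpos he θ σ hx, Real.one_le_exp_iff]
  nlinarith

lemma airyRoot_cube_re {e θ : ℝ} (hθ : 0 < θ) (he : e = 1 ∨ e = -1) (σ : ℝ) :
    (airyRoot e θ σ ^ 3).re = -(e * σ) / θ := by
  rw [airyRoot_cube hθ he, Complex.div_ofReal_re, mul_assoc, Complex.re_ofReal_mul,
    Complex.I_mul_re, freq_im]
  ring

lemma tendsto_rampWave {e θ : ℝ} (hθ : IsSmallSlope θ) (he : e = 1 ∨ e = -1) {σ : ℝ}
    (h : e * σ < 0) : Tendsto (rampWave e θ σ) atTop (𝓝 0) := by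
  have h1 := tendsto_rampProfile_zero hθ.1 (inAirySector_airyRoot hθ he σ)
    (by rw [airyRoot_cube_re hθ.1 he]; exact div_pos (by linarith) hθ.1)
  refine h1.congr' ?_
  filter_upwards [eventually_ge_atTop 0] with x hx using (rampWave_of_nonneg hθ he σ hx).symm

lemma not_tendsto_rampWave {e θ : ℝ} (hθ : IsSmallSlope θ) (he : e = 1 ∨ e = -1) {σ : ℝ}
    (h : 0 < e * σ) : ¬ Tendsto (rampWave e θ σ) atTop (𝓝 0) := by
  intro h'
  refine not_tendsto_rampProfile_zero hθ.1 (inAirySector_airyRoot hθ he σ)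
    (by rw [airyRoot_cube_re hθ.1 he]; exact div_neg_of_neg_of_pos (by linarith) hθ.1)
    (h'.congr' ?_)
  filter_upwards [eventually_ge_atTop 0] with x hx using rampWave_of_nonneg hθ he σ hx

lemma continuous_rampWave {e θ : ℝ} (hθ : IsSmallSlope θ) (he : e = 1 ∨ e = -1) :
    Continuous fun q : ℝ × ℝ => rampWave e θ q.1 q.2 :=
  continuous_cauchySolution hθ (c₀ := fun _ => 1) (c₁ := airySlope e θ) continuous_const
    (continuous_airySlope hθ he)

lemma continuous_planeWave (e : ℝ) {θ : ℝ} (hθ : IsSmallSlope θ) :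
    Continuous fun q : ℝ × ℝ => planeWave e θ q.1 q.2 :=
  continuous_cauchySolution hθ (c₀ := fun _ => 1) (c₁ := fun σ => e * Complex.I * freq σ)
    continuous_const (continuous_freq.const_mul _)

lemma planeWave_slopes_ne (σ : ℝ) :
    ((1 : ℝ) : ℂ) * Complex.I * freq σ ≠ ((-1 : ℝ) : ℂ) * Complex.I * freq σ := by
  intro h
  push_cast at h
  have h2 : 2 * (Complex.I * freq σ) = 0 := by linear_combination h
  exact mul_ne_zero two_ne_zero (mul_ne_zero Complex.I_ne_zero (freq_ne_zero σ)) h2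

lemma isOutgoingToPosInf_rampWave {θ : ℝ} (hθ : IsSmallSlope θ) :
    IsOutgoingToPosInf 1 θ (rampWave 1 θ 0) :=
  isPolarizedWave_of_family (continuous_rampWave hθ (Or.inl rfl))
    (fun _ => isWaveSolution_cauchySolution hθ _ _ _)
    (by rw [rampWave, cauchySolution_zero]; exact one_ne_zero)
    (fun σ (hσ : σ < 0) => tendsto_rampWave hθ (Or.inl rfl) (by linarith))
    (by rw [closure_Iio]; exact Set.mem_Iic.2 le_rfl)

lemma isOutgoingToNegInf_planeWave {θ : ℝ} (hθ : IsSmallSlope θ) :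
    IsOutgoingToNegInf 1 θ (planeWave 1 θ 0) :=
  isPolarizedWave_of_family (continuous_planeWave 1 hθ)
    (fun _ => isWaveSolution_cauchySolution hθ _ _ _)
    (by rw [planeWave, cauchySolution_zero]; exact one_ne_zero)
    (fun σ (hσ : σ < 0) => tendsto_planeWave (Or.inl rfl) θ (by linarith))
    (by rw [closure_Iio]; exact Set.mem_Iic.2 le_rfl)

lemma isIncomingFromNegInf_planeWave {θ : ℝ} (hθ : IsSmallSlope θ) :
    IsIncomingFromNegInf 1 θ (planeWave (-1) θ 0) :=
  isPolarizedWave_of_family (continuous_planeWave (-1) hθ)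
    (fun _ => isWaveSolution_cauchySolution hθ _ _ _)
    (by rw [planeWave, cauchySolution_zero]; exact one_ne_zero)
    (fun σ (hσ : 0 < σ) => tendsto_planeWave (Or.inr rfl) θ (by linarith))
    (by rw [closure_Ioi]; exact Set.mem_Ici.2 le_rfl)

lemma IsOutgoingToPosInf.eq_mul_rampWave {θ : ℝ} (hθ : IsSmallSlope θ) {u : ℝ → ℂ}
    (hu : IsOutgoingToPosInf 1 θ u) (x : ℝ) : u x = u 0 * rampWave 1 θ 0 x :=
  IsPolarizedWave.eq_mul (continuous_rampWave hθ (Or.inl rfl))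
    (fun σ (hσ : σ < 0) _ hv hvl => eq_mul_of_tendsto_zero (T' := rampWave (-1) θ σ)
      (isWaveSolution_cauchySolution hθ _ _ _) (isWaveSolution_cauchySolution hθ _ _ _)
      (cauchySolution_zero _ _ _ _) (cauchySolution_zero _ _ _ _)
      (by rw [rampWave, rampWave, deriv_cauchySolution_zero hθ, deriv_cauchySolution_zero hθ]
          exact (sub_ne_zero.1 (airySlope_sub_ne_zero hθ σ)).symm)
      (tendsto_rampWave hθ (Or.inl rfl) (by linarith))
      (not_tendsto_rampWave hθ (Or.inr rfl) (by linarith)) hv hvl) hu x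

lemma IsOutgoingToNegInf.eq_mul_planeWave {θ : ℝ} (hθ : IsSmallSlope θ) {u : ℝ → ℂ}
    (hu : IsOutgoingToNegInf 1 θ u) (x : ℝ) : u x = u 0 * planeWave 1 θ 0 x :=
  IsPolarizedWave.eq_mul (continuous_planeWave 1 hθ)
    (fun σ (hσ : σ < 0) _ hv hvl => eq_mul_of_tendsto_zero (T' := planeWave (-1) θ σ)
      (isWaveSolution_cauchySolution hθ _ _ _) (isWaveSolution_cauchySolution hθ _ _ _)
      (cauchySolution_zero _ _ _ _) (cauchySolution_zero _ _ _ _)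
      (by rw [planeWave, planeWave, deriv_cauchySolution_zero hθ, deriv_cauchySolution_zero hθ]
          exact planeWave_slopes_ne σ)
      (tendsto_planeWave (Or.inl rfl) θ (by linarith))
      (not_tendsto_planeWave (Or.inr rfl) θ (by linarith)) hv hvl) hu x

lemma IsIncomingFromNegInf.eq_mul_planeWave {θ : ℝ} (hθ : IsSmallSlope θ) {u : ℝ → ℂ}
    (hu : IsIncomingFromNegInf 1 θ u) (x : ℝ) : u x = u 0 * planeWave (-1) θ 0 x :=
  IsPolarizedWave.eq_mul (continuous_planeWave (-1) hθ)
    (fun σ (hσ : 0 < σ) _ hv hvl => eq_mul_of_tendsto_zero (T' := planeWave 1 θ σ)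
      (isWaveSolution_cauchySolution hθ _ _ _) (isWaveSolution_cauchySolution hθ _ _ _)
      (cauchySolution_zero _ _ _ _) (cauchySolution_zero _ _ _ _)
      (by rw [planeWave, planeWave, deriv_cauchySolution_zero hθ, deriv_cauchySolution_zero hθ]
          exact (planeWave_slopes_ne σ).symm)
      (tendsto_planeWave (Or.inr rfl) θ (by linarith))
      (not_tendsto_planeWave (Or.inl rfl) θ (by linarith)) hv hvl) hu x

/-! ### The reflection coefficient -/

lemma waveSpeed_of_nonpos (θ : ℝ) {x : ℝ} (hx : x ≤ 0) : waveSpeed 1 θ x = 1 := by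
  rw [waveSpeed, invSqSpeed_one, max_eq_right hx]
  simp

lemma phase_of_nonpos (θ : ℝ) {x : ℝ} (hx : x ≤ 0) : phase 1 θ x = x := by
  have h : ∀ y ∈ Set.uIcc (0 : ℝ) x, 1 / waveSpeed 1 θ y = 1 := fun y hy => by
    rw [Set.uIcc_of_ge hx] at hy
    rw [waveSpeed_of_nonpos θ hy.2, div_one]
  rw [phase, intervalIntegral.integral_congr h]
  simp

lemma planeWave_div_wkbLeft (θ : ℝ) {x : ℝ} (hx : x ≤ 0) :
    planeWave 1 θ 0 x / wkbLeft 1 θ x = 1 := by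
  rw [planeWave_of_nonpos (Or.inl rfl) θ 0 hx, wkbLeft, waveSpeed_of_nonpos θ hx,
    phase_of_nonpos θ hx, freq_zero]
  simp [Complex.exp_ne_zero]

lemma planeWave_div_wkbRight (θ : ℝ) {x : ℝ} (hx : x ≤ 0) :
    planeWave (-1) θ 0 x / wkbRight 1 θ x = 1 := by
  rw [planeWave_of_nonpos (Or.inr rfl) θ 0 hx, wkbRight, waveSpeed_of_nonpos θ hx,
    phase_of_nonpos θ hx, freq_zero]
  simp [Complex.exp_ne_zero]

/-- The WKB normalisation at `-∞` fixes the constant factor. -/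
lemma eq_of_eq_mul_of_tendsto_div {u T w : ℝ → ℂ} (hu : ∀ x, u x = u 0 * T x)
    (hT : ∀ x ≤ 0, T x / w x = 1) (hlim : Tendsto (fun x => u x / w x) atBot (𝓝 1)) : u = T := by
  have h1 : Tendsto (fun x => u x / w x) atBot (𝓝 (u 0)) := by
    refine tendsto_const_nhds.congr' ?_
    filter_upwards [eventually_le_atBot 0] with x hx
    rw [hu x, mul_div_assoc, hT x hx, mul_one]
  have h2 := tendsto_nhds_unique h1 hlim
  funext x
  rw [hu x, h2, one_mul]

/-- The Cauchy data of `A uRefl + B uInc` are `(A + B, i(A - B))`; conversely, a solution with data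
`(c, cp)` has coefficients in the ratio `(1 - ip) / (1 + ip)`. -/
lemma isReflectionCoefficient_iff {θ : ℝ} (hθ : IsSmallSlope θ)
    (hB : 1 + Complex.I * airySlope 1 θ 0 ≠ 0) (R : ℂ) :
    IsReflectionCoefficient 1 θ R ↔
      R = (1 - Complex.I * airySlope 1 θ 0) / (1 + Complex.I * airySlope 1 θ 0) := by
  set p := airySlope 1 θ 0 with hp
  have hI := Complex.I_sq
  constructor
  · rintro ⟨u, uR, uI, A, B, hu, huR, hR, huI, hI', hsum, hB0, rfl⟩
    have e1 := hu.eq_mul_rampWave hθ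
    have hc := hu.apply_zero_ne_zero e1
    have e2 : uR = planeWave 1 θ 0 := eq_of_eq_mul_of_tendsto_div (huR.eq_mul_planeWave hθ)
      (fun x hx => planeWave_div_wkbLeft θ hx) hR
    have e3 : uI = planeWave (-1) θ 0 := eq_of_eq_mul_of_tendsto_div (huI.eq_mul_planeWave hθ)
      (fun x hx => planeWave_div_wkbRight θ hx) hI'
    set c := u 0 with hcdef
    have hsum' : (fun x => c * rampWave 1 θ 0 x)
        = fun x => A * planeWave 1 θ 0 x + B * planeWave (-1) θ 0 x := by
      funext x
      rw [← e1 x, hsum x, e2, e3]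
    have hd : ∀ c₁ : ℂ, HasDerivAt (cauchySolution θ 0 1 c₁) c₁ 0 := fun c₁ => by
      have := ((isWaveSolution_cauchySolution hθ 0 1 c₁).1 0).hasDerivAt
      rwa [deriv_cauchySolution_zero hθ] at this
    have f0 := congrFun hsum' 0
    simp only [rampWave, planeWave, cauchySolution_zero, mul_one] at f0
    have f1 : c * p = A * Complex.I - B * Complex.I := by
      have h1 := (hd p).const_mul c
      have h2 := ((hd (((1 : ℝ) : ℂ) * Complex.I * freq 0)).const_mul A).add
        ((hd (((-1 : ℝ) : ℂ) * Complex.I * freq 0)).const_mul B)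
      have h3 := (h1.congr_of_eventuallyEq (Eventually.of_forall (congrFun hsum'.symm))).unique h2
      rw [h3, freq_zero]
      push_cast
      ring
    rw [div_eq_div_iff hB0 hB]
    refine mul_left_cancel₀ hc ?_
    linear_combination (A - B) * f0 + (Complex.I * A + Complex.I * B) * f1
      + (A - B) * (A + B) * hI
  · rintro rfl
    refine ⟨rampWave 1 θ 0, planeWave 1 θ 0, planeWave (-1) θ 0, (1 - Complex.I * p) / 2,
      (1 + Complex.I * p) / 2, isOutgoingToPosInf_rampWave hθ, isOutgoingToNegInf_planeWave hθ, ?_,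
      isIncomingFromNegInf_planeWave hθ, ?_, fun x => ?_, ?_, ?_⟩
    · refine tendsto_const_nhds.congr' ?_
      filter_upwards [eventually_le_atBot 0] with x hx using (planeWave_div_wkbLeft θ hx).symm
    · refine tendsto_const_nhds.congr' ?_
      filter_upwards [eventually_le_atBot 0] with x hx using (planeWave_div_wkbRight θ hx).symm
    · simp only [rampWave, planeWave, cauchySolution, glueAtZero, airyComb, flatSolution,
        freq_zero, ← hp]
      push_cast
      have h := airySlope_sub_ne_zero hθ 0
      rw [← hp] at h
      field_simp
      ring_nf
      rw [hI]
      ring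
    · exact div_ne_zero hB two_ne_zero
    · field_simp

/-- Expansion of `(1 - ip)/(1 + ip)` for `p = -i - δ`, with `δ = (θ/4)(1 - iε)` and `|ε| ≤ Kθ`. -/
lemma norm_reflection_sub_le {θ K : ℝ} (hθ : 0 < θ) (h1 : θ < 1) (hK : K * θ ≤ 1) {ε δ : ℂ}
    (hε : ‖ε‖ ≤ K * θ) (hδ : δ = θ / 4 * (1 - Complex.I * ε)) :
    2 - Complex.I * δ ≠ 0 ∧
      ‖Complex.I * δ / (2 - Complex.I * δ) - Complex.I * θ / 8‖ ≤ (1 + K) * θ ^ 2 := by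
  have hδn : ‖δ‖ ≤ θ / 2 := by
    have h2 : ‖(1 : ℂ) - Complex.I * ε‖ ≤ 2 := by
      refine (norm_sub_le _ _).trans ?_
      rw [norm_one, norm_mul, Complex.norm_I, one_mul]
      linarith
    rw [hδ, norm_mul, norm_div, Complex.norm_real, Real.norm_eq_abs, abs_of_pos hθ]
    norm_num
    nlinarith
  have hden : 1 ≤ ‖2 - Complex.I * δ‖ := by
    have h3 := norm_sub_norm_le (2 : ℂ) (Complex.I * δ)
    rw [norm_mul, Complex.norm_I, one_mul] at h3
    norm_num at h3
    linarith
  have hden0 : 2 - Complex.I * δ ≠ 0 := norm_pos_iff.1 (by linarith)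
  refine ⟨hden0, ?_⟩
  have hI := Complex.I_sq
  have h4 : Complex.I * δ / (2 - Complex.I * δ) - Complex.I * θ / 8
      = -(δ ^ 2 / (2 * (2 - Complex.I * δ))) + θ * ε / 8 := by
    have h5 : Complex.I * δ / (2 - Complex.I * δ)
        = Complex.I * δ / 2 - δ ^ 2 / (2 * (2 - Complex.I * δ)) := by
      field_simp
      linear_combination δ ^ 2 * hI
    rw [h5, hδ]
    linear_combination (-θ * ε / 8) * hI
  rw [h4]
  have h6 : ‖δ ^ 2 / (2 * (2 - Complex.I * δ))‖ ≤ θ ^ 2 := by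
    rw [norm_div, norm_pow, norm_mul]
    norm_num
    rw [div_le_iff₀ (by linarith)]
    nlinarith [norm_nonneg δ]
  have h7 : ‖(θ : ℂ) * ε / 8‖ ≤ K * θ ^ 2 := by
    rw [norm_div, norm_mul, Complex.norm_real, Real.norm_eq_abs, abs_of_pos hθ]
    norm_num
    nlinarith [norm_nonneg ε]
  calc _ ≤ ‖-(δ ^ 2 / (2 * (2 - Complex.I * δ)))‖ + ‖(θ : ℂ) * ε / 8‖ := norm_add_le _ _
    _ ≤ θ ^ 2 + K * θ ^ 2 := by rw [norm_neg]; gcongr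
    _ = _ := by ring

theorem mainTheorem9 :
    (∃ θ₀ : ℝ, 0 < θ₀ ∧ ∃ C : ℝ, ∀ θ : ℝ, 0 < θ → θ < θ₀ →
      (∃! R : ℂ, IsReflectionCoefficient 1 θ R) ∧
      ∀ R : ℂ, IsReflectionCoefficient 1 θ R →
        ‖R - Complex.I * (θ : ℂ) / 8‖ ≤ C * θ ^ 2) ∧
    Complex.I / 8 = 1 / (2 * Complex.I) ^ 3 := by
  refine ⟨?_, ?_⟩
  · set K3 := gaussianAbsMoment 3
    set K6 := gaussianAbsMoment 6
    have hK6 : 0 ≤ K6 := gaussianAbsMoment_nonneg 6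
    have hM : 0 < 1 + K3 ^ 2 + K6 := by positivity
    refine ⟨1 / (1 + K3 ^ 2 + K6), by positivity, 1 + K6, fun θ h0 hlt => ?_⟩
    have hlt' : θ * (1 + K3 ^ 2 + K6) < 1 := (lt_div_iff₀ hM).1 hlt
    have hK3 : 0 ≤ K3 ^ 2 * θ := by positivity
    have hK6' : 0 ≤ K6 * θ := by positivity
    have hθ : IsSmallSlope θ := ⟨h0, by nlinarith, by nlinarith, by nlinarith⟩
    have hε := norm_airyRoot_ratio_le hθ (Or.inl rfl : (1 : ℝ) = 1 ∨ (1 : ℝ) = -1) 0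
    rw [← airyRemainder] at hε
    obtain ⟨hne, hbound⟩ := norm_reflection_sub_le h0 hθ.2.1 hθ.2.2.2 hε rfl
    have hslope := airySlope_eq hθ (Or.inl rfl : (1 : ℝ) = 1 ∨ (1 : ℝ) = -1) 0
    set δ : ℂ := θ / 4 * (1 - Complex.I * airyRemainder 1 θ 0)
    rw [freq_zero, Complex.ofReal_one, one_mul, mul_one] at hslope
    have hplus : 1 + Complex.I * airySlope 1 θ 0 = 2 - Complex.I * δ := by
      rw [hslope]
      linear_combination -Complex.I_sq
    have hminus : 1 - Complex.I * airySlope 1 θ 0 = Complex.I * δ := by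
      rw [hslope]
      linear_combination Complex.I_sq
    have hiff := isReflectionCoefficient_iff hθ (by rw [hplus]; exact hne)
    rw [hplus, hminus] at hiff
    refine ⟨⟨_, (hiff _).2 rfl, fun R hR => (hiff R).1 hR⟩, fun R hR => ?_⟩
    rw [(hiff R).1 hR]
    exact hbound
  · have hI := Complex.I_ne_zero
    have hI2 := Complex.I_sq
    field_simp
    linear_combination (8 * Complex.I ^ 2 - 8) * hI2
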